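/- Let $S$ be a dense subgroup of $\mathbb{R}$ and $b\in S_{>0}\cup\{\infty\}$, and let $\mathcal{S}_b=\{r\in S : 0\le r\le b\}$. An $\mathcal{S}_b$-metric space is a metric space all of whose distances lie in $\mathcal{S}_b$. An $\mathcal{S}_b$-Urysohn space is an $\mathcal{S}_b$-metric space $U$ such that every finite $\mathcal{S}_b$-metric space embeds isometrically into $U$ and every isometry between finite subspaces of $U$ extends to an isometry of $U$ onto itself. A family $\mathcal{Y}$ of subsets of a group generates a group topology at the identity if it generates the filter of neighbourhoods of $1$ of that topology. Let $U$ be an $\mathcal{S}_b$-Urysohn space and $G=\mathrm{Isom}(U)$ its group of isometries onto itself. Then the following families generate group topologies on $G$ at the identity: - $\tau_{st}$: the pointwise stabilizers $\{g\in G : ga=a \text{ for all } a\in A\}$ of the finite sets $A\subseteq U$; - $\tau_{0^+,0}$: the sets $\{g\in G : d(gu,v)\le d(u,v)\}$ with $u,v\in U$, $d(u,v)>0$ (equivalently, the sets $\{g\in G : d(gu,v)=d(u,v)\}$ with $u,v\in U$, $0<d(u,v)<b$); - $\tau_m$: the sets $\{g\in G : d(gu,u)\le\varepsilon\}$ with $u\in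 U$, $\varepsilon\in\mathcal{S}_b\setminus\{0\}$. Moreover, there are exactly $4$ group topologies on $G$ (not necessarily Hausdorff) coarser than or equal to $\tau_{st}$, namely $$\tau_{st}\supsetneq\tau_{0^+,0}\supsetneq\tau_m\supsetneq\{\emptyset,G\}.$$ -/

import Mathlib

/-- The underlying set `{r ∈ S : 0 ≤ r ≤ b}` of the distance monoid `𝒮_b`; here `b = ⊤` means
`b = ∞`. Its operation is `min (x + y) b`. -/
def distanceSet (S : AddSubgroup ℝ) (b : WithTop ℝ) : Set ℝ :=
  {r | r ∈ S ∧ 0 ≤ r ∧ (r : WithTop ℝ) ≤ b}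

/-- An `𝒮_b`-metric space: a metric space whose distances all lie in `𝒮_b`. Since distances
are at most `b`, the usual triangle inequality is the same as
`d(x, z) ≤ min (d(x, y) + d(y, z)) b`. -/
def IsSbMetric (S : AddSubgroup ℝ) (b : WithTop ℝ) (X : Type*) [MetricSpace X] : Prop :=
  ∀ x y : X, dist x y ∈ distanceSet S b

/-- An `𝒮_b`-Urysohn space: an `𝒮_b`-metric space in which every finite `𝒮_b`-metric space
embeds isometrically, and in which every isometry between finite subspaces extends to an
isometry of the whole space onto itself. No countability, separability or completeness. -/
structure IsUrysohnSpace (S : AddSubgroup ℝ) (b : WithTop ℝ) (U : Type*) [MetricSpace U] :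
    Prop where
  isSbMetric : IsSbMetric S b U
  universal : ∀ (F : Type) [Finite F] [MetricSpace F], IsSbMetric S b F →
    ∃ f : F → U, Isometry f
  homogeneous : ∀ (A B : Set U), A.Finite → B.Finite → ∀ φ : A ≃ᵢ B,
    ∃ g : U ≃ᵢ U, ∀ a : A, g a = φ a

/-- The family `Y` of subsets of `G` generates the group topology `τ` at the identity: it
generates the filter of `τ`-neighbourhoods of `1`. This determines `τ`. -/
def GeneratesAtOne {G : Type*} [Group G] (Y : Set (Set G)) (τ : GroupTopology G) : Prop :=
  @nhds G τ.toTopologicalSpace 1 = Filter.generate Y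

/-- The pointwise stabilizers of the finite subsets of `U`. -/
def stabilizerSets (U : Type*) [MetricSpace U] : Set (Set (U ≃ᵢ U)) :=
  {V | ∃ A : Set U, A.Finite ∧ V = {g | ∀ a ∈ A, g a = a}}

/-- The sets `{g : d(gu, v) ≤ d(u, v)}` with `d(u, v) > 0`. -/
def sphericalSets (U : Type*) [MetricSpace U] : Set (Set (U ≃ᵢ U)) :=
  {V | ∃ u v : U, 0 < dist u v ∧ V = {g | dist (g u) v ≤ dist u v}}

/-- The sets `{g : d(gu, v) = d(u, v)}` with `0 < d(u, v) < b`. -/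
def sphericalEqSets (b : WithTop ℝ) (U : Type*) [MetricSpace U] : Set (Set (U ≃ᵢ U)) :=
  {V | ∃ u v : U, 0 < dist u v ∧ (dist u v : WithTop ℝ) < b ∧
    V = {g | dist (g u) v = dist u v}}

/-- The sets `{g : d(gu, u) ≤ ε}` with `u ∈ U` and `ε` a non-zero element of `𝒮_b`. -/
def metricSets (S : AddSubgroup ℝ) (b : WithTop ℝ) (U : Type*) [MetricSpace U] :
    Set (Set (U ≃ᵢ U)) :=
  {V | ∃ (u : U) (ε : ℝ), ε ∈ distanceSet S b ∧ ε ≠ 0 ∧ V = {g | dist (g u) u ≤ ε}}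

/-! Let `N` be the filter of neighbourhoods of 1 for a group topology coarser than the stabilizer
topology. Given `V ∈ N`, take a symmetric `W ∈ N` with `W⁹ ⊆ V` and a finite `A` whose pointwise
stabilizer lies in `W`. If some `g ∈ W` satisfies `d(hx, y) ≤ d(x, gz) + d(gz, y)` for all `x, y, z
∈ A`, then `h` is a product of nine elements of `W`, so `h ∈ V` (`exists_eq_mul_conj_fixing`,
`mem_of_forall_dist_le`). Thus the further `W` can carry `A` from itself, the more `h` are forced
into `V`.

How far it can be carried depends on the basic sets missing from `N`. Without some point stabilizer,
finite sets can be moved off themselves, and `V` is a spherical neighbourhood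
(`mem_of_stabilizer_notMem`). If a spherical set is missing but all metric ones are present, some `g
∈ W` decreases no distance `d(x, y)` on `A` to `d(gx, y)` and strictly increases the non-maximal
ones, which leaves room for every `h` near 1 (`mem_of_spherical_notMem`). If a metric set is
missing, displacements can be doubled repeatedly by free amalgamation, and every `h` lies in `V`
(`eq_univ_of_not_small`).

The inclusions are strict because there are isometries whose distances `d(gx, y)` on a finite set
are `max (d(x, y)) t`, or `min (d(x, y) + t) M`. -/

open Filter Topology

/-! ### The set of distances -/

section DistanceSet

variable {S : AddSubgroup ℝ} {b : WithTop ℝ}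

theorem distanceSet_nonneg {r : ℝ} (hr : r ∈ distanceSet S b) : 0 ≤ r := hr.2.1

theorem distanceSet_of_le {r s : ℝ} (hr : r ∈ distanceSet S b) (hs : s ∈ S) (h0 : 0 ≤ s)
    (hsr : s ≤ r) : s ∈ distanceSet S b :=
  ⟨hs, h0, (WithTop.coe_le_coe.2 hsr).trans hr.2.2⟩

theorem distanceSet_max {r s : ℝ} (hr : r ∈ distanceSet S b) (hs : s ∈ distanceSet S b) :
    max r s ∈ distanceSet S b := by
  rcases max_choice r s with h | h <;> rw [h] <;> assumption

theorem distanceSet_exists_pos_le (hS : Dense (S : Set ℝ))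
    (hb : b = ⊤ ∨ ∃ c : ℝ, c ∈ S ∧ 0 < c ∧ b = (c : WithTop ℝ)) {ε : ℝ} (hε : 0 < ε) :
    ∃ r ∈ distanceSet S b, 0 < r ∧ r ≤ ε := by
  rcases hb with rfl | ⟨c, hc, hc0, rfl⟩
  · obtain ⟨r, hrS, hr⟩ := hS.exists_between hε
    exact ⟨r, ⟨hrS, hr.1.le, le_top⟩, hr.1, hr.2.le⟩
  · obtain ⟨r, hrS, hr⟩ := hS.exists_between (lt_min hε hc0)
    exact ⟨r, ⟨hrS, hr.1.le, WithTop.coe_le_coe.2 (hr.2.le.trans (min_le_right _ _))⟩, hr.1,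
      hr.2.le.trans (min_le_left _ _)⟩

end DistanceSet

/-! ### Homogeneity, amalgamation and double cosets of stabilizers -/

section Urysohn

variable {U : Type*} [MetricSpace U]

/-- Indexed families may repeat points, so unions such as `A ∪ X` can be treated as sums without
disjointness. -/
theorem exists_isometryEquiv_of_dist_eq {S : AddSubgroup ℝ} {b : WithTop ℝ}
    (hU : IsUrysohnSpace S b U) {ι : Type*} [Finite ι] (x y : ι → U)
    (h : ∀ i j, dist (x i) (x j) = dist (y i) (y j)) :
    ∃ g : U ≃ᵢ U, ∀ i, g (x i) = y i := by
  classical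
  choose s hs using fun p : Set.range x => p.2
  have key : ∀ i, y (s ⟨x i, i, rfl⟩) = y i := fun i => by
    rw [← dist_le_zero, ← h, hs, dist_self]
  let f : Set.range x → Set.range y := fun p => ⟨y (s p), s p, rfl⟩
  have hf : Isometry f := Isometry.of_dist_eq fun p q => by
    rw [Subtype.dist_eq, Subtype.dist_eq, ← h, hs, hs]
  have hsurj : Function.Surjective f := by
    rintro ⟨_, i, rfl⟩
    exact ⟨⟨x i, i, rfl⟩, Subtype.ext (key i)⟩
  obtain ⟨g, hg⟩ := hU.homogeneous _ _ (Set.finite_range x) (Set.finite_range y)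
    ⟨Equiv.ofBijective f ⟨hf.injective, hsurj⟩, hf⟩
  exact ⟨g, fun i => (hg ⟨x i, i, rfl⟩).trans (key i)⟩

theorem exists_isometry_of_pseudoMetricSpace {S : AddSubgroup ℝ} {b : WithTop ℝ}
    (hU : IsUrysohnSpace S b U) (F : Type) [Finite F] [PseudoMetricSpace F]
    (hF : ∀ i j : F, dist i j ∈ distanceSet S b) :
    ∃ z : F → U, Isometry z := by
  have : Finite (SeparationQuotient F) := Quotient.finite _
  obtain ⟨f, hf⟩ := hU.universal (SeparationQuotient F) (by
    intro x y
    obtain ⟨x, rfl⟩ := SeparationQuotient.surjective_mk x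
    obtain ⟨y, rfl⟩ := SeparationQuotient.surjective_mk y
    rw [SeparationQuotient.dist_mk]
    exact hF _ _)
  exact ⟨f ∘ SeparationQuotient.mk, Isometry.of_dist_eq fun x y => by
    rw [Function.comp_apply, Function.comp_apply, hf.dist_eq, SeparationQuotient.dist_mk]⟩

theorem exists_tuple_of_pseudometric {S : AddSubgroup ℝ} {b : WithTop ℝ}
    (hU : IsUrysohnSpace S b U) {ι : Type*} [Finite ι] (R : ι → ι → ℝ)
    (hR : ∀ i j, R i j ∈ distanceSet S b) (h0 : ∀ i, R i i = 0) (hc : ∀ i j, R i j = R j i)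
    (ht : ∀ i j k, R i k ≤ R i j + R j k) :
    ∃ z : ι → U, ∀ i j, dist (z i) (z j) = R i j := by
  obtain ⟨n, ⟨e⟩⟩ := Finite.exists_equiv_fin ι
  let m : PseudoMetricSpace (Fin n) :=
    { dist := fun i j => R (e.symm i) (e.symm j)
      dist_self := fun i => h0 _
      dist_comm := fun i j => hc _ _
      dist_triangle := fun i j k => ht _ _ _ }
  obtain ⟨f, hf⟩ := @exists_isometry_of_pseudoMetricSpace U _ S b hU (Fin n) _ m
    (fun i j => hR _ _)
  refine ⟨fun i => f (e i), fun i j => (hf.dist_eq _ _).trans ?_⟩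
  change R (e.symm (e i)) (e.symm (e j)) = R i j
  rw [e.symm_apply_apply, e.symm_apply_apply]

/-- A finite set `X` can be moved by an isometry fixing the finite set `A ⊆ C` pointwise so that
its distances to `C` are any prescribed ones compatible with the triangle inequalities. -/
theorem exists_fixing_of_dist {S : AddSubgroup ℝ} {b : WithTop ℝ}
    (hU : IsUrysohnSpace S b U) (A C X : Finset U) (hAC : A ⊆ C) (ρ : U → U → ℝ)
    (hD : ∀ x ∈ X, ∀ c ∈ C, ρ x c ∈ distanceSet S b)
    (h1 : ∀ x ∈ X, ∀ c ∈ C, ∀ c' ∈ C, ρ x c ≤ ρ x c' + dist c c')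
    (h2 : ∀ x ∈ X, ∀ c ∈ C, ∀ c' ∈ C, dist c c' ≤ ρ x c + ρ x c')
    (h3 : ∀ x ∈ X, ∀ x' ∈ X, ∀ c ∈ C, ρ x c ≤ ρ x' c + dist x x')
    (h4 : ∀ x ∈ X, ∀ x' ∈ X, ∀ c ∈ C, dist x x' ≤ ρ x c + ρ x' c)
    (hA : ∀ x ∈ X, ∀ a ∈ A, ρ x a = dist x a) :
    ∃ k : U ≃ᵢ U, (∀ a ∈ A, k a = a) ∧ ∀ x ∈ X, ∀ c ∈ C, dist (k x) c = ρ x c := by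
  -- The amalgam of `C` and `X`; it may identify points, hence only a pseudometric.
  let R : C ⊕ X → C ⊕ X → ℝ := fun i j => match i, j with
    | .inl c, .inl c' => dist c c'
    | .inl c, .inr x => ρ x c
    | .inr x, .inl c => ρ x c
    | .inr x, .inr x' => dist x x'
  obtain ⟨z, hz⟩ := exists_tuple_of_pseudometric hU R (by
      rintro (⟨c, hc⟩ | ⟨x, hx⟩) (⟨c', hc'⟩ | ⟨x', hx'⟩)
      exacts [hU.isSbMetric c c', hD _ hx' _ hc, hD _ hx _ hc', hU.isSbMetric x x'])
    (by rintro (c | x) <;> exact dist_self _)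
    (by rintro (c | x) (c' | x') <;> first | rfl | exact dist_comm _ _)
    (by
      rintro (⟨c, hc⟩ | ⟨x, hx⟩) (⟨c', hc'⟩ | ⟨x', hx'⟩) (⟨d, hd⟩ | ⟨y, hy⟩)
      · exact dist_triangle c c' d
      · have := h1 y hy c hc c' hc'
        change ρ y c ≤ dist c c' + ρ y c'
        linarith
      · exact h2 x' hx' c hc d hd
      · have := h3 y hy x' hx' c hc
        change ρ y c ≤ ρ x' c + dist x' y
        rw [dist_comm x']; exact this
      · have := h1 x hx d hd c' hc'
        change ρ x d ≤ ρ x c' + dist c' d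
        rw [dist_comm c']; exact this
      · exact h4 x hx y hy c' hc'
      · have := h3 x hx x' hx' d hd
        change ρ x d ≤ dist x x' + ρ x' d
        linarith
      · exact dist_triangle x x' y)
  -- Universality gives only a copy of the amalgam. Homogeneity brings its part `C` back into place,
  -- and then carries `X` onto its copy over `A`.
  obtain ⟨g, hg⟩ := exists_isometryEquiv_of_dist_eq hU (fun c : C => z (.inl c))
    (fun c : C => (c : U)) (fun c c' => hz _ _)
  have hy : ∀ x : X, ∀ c ∈ C, dist (g (z (.inr x))) c = ρ x c := fun x c hc => by
    have := hz (.inr x) (.inl ⟨c, hc⟩)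
    rwa [← g.dist_eq, hg] at this
  obtain ⟨k, hk⟩ := exists_isometryEquiv_of_dist_eq hU
    (Sum.elim (fun a : A => (a : U)) (fun x : X => (x : U)))
    (Sum.elim (fun a : A => (a : U)) (fun x : X => g (z (.inr x)))) (by
      rintro (⟨a, ha⟩ | ⟨x, hx⟩) (⟨a', ha'⟩ | ⟨x', hx'⟩)
      · rfl
      · simp only [Sum.elim_inl, Sum.elim_inr]
        rw [dist_comm a (g _), hy _ a (hAC ha), hA x' hx' a ha, dist_comm]
      · simp only [Sum.elim_inl, Sum.elim_inr]
        rw [hy _ a' (hAC ha'), hA x hx a' ha']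
      · simp only [Sum.elim_inr]
        rw [g.dist_eq, hz]
        rfl)
  refine ⟨k, fun a ha => hk (.inl ⟨a, ha⟩), fun x hx c hc => ?_⟩
  rw [← hy ⟨x, hx⟩ c hc]
  exact congrArg (dist · c) (hk (.inr ⟨x, hx⟩))

theorem exists_bound_dist {S : AddSubgroup ℝ} {b : WithTop ℝ} (hU : IsUrysohnSpace S b U)
    (C : Finset U) {K : ℝ} (hK : K ∈ distanceSet S b) :
    ∃ M ∈ distanceSet S b, K ≤ M ∧ ∀ x ∈ C, ∀ y ∈ C, dist x y ≤ M := by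
  have : ∀ T : Finset (U × U), ∃ M ∈ distanceSet S b, K ≤ M ∧ ∀ p ∈ T, dist p.1 p.2 ≤ M := by
    classical
    intro T
    induction T using Finset.induction_on with
    | empty => exact ⟨K, hK, le_rfl, by simp⟩
    | insert p T _ ih =>
      obtain ⟨M, hM, hKM, h⟩ := ih
      refine ⟨max M (dist p.1 p.2), distanceSet_max hM (hU.isSbMetric _ _), le_max_of_le_left hKM,
        fun q hq => ?_⟩
      rcases Finset.mem_insert.1 hq with rfl | hq
      · exact le_max_right _ _
      · exact le_max_of_le_left (h q hq)
  obtain ⟨M, hM, hKM, h⟩ := this (C ×ˢ C)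
  exact ⟨M, hM, hKM, fun x hx y hy => h (x, y) (Finset.mk_mem_product hx hy)⟩

/-- Free amalgamation: a finite set `X` can be moved over `A` to a copy that is as far as possible
from `C`. -/
theorem exists_fixing_free {S : AddSubgroup ℝ} {b : WithTop ℝ}
    (hU : IsUrysohnSpace S b U) (A X C : Finset U) (hAne : A.Nonempty) {K : ℝ}
    (hK : K ∈ distanceSet S b) :
    ∃ k : U ≃ᵢ U, (∀ a ∈ A, k a = a) ∧
      ∀ x ∈ X, ∀ c ∈ C, K ≤ dist (k x) c ∨ ∃ a ∈ A, dist x a + dist a c ≤ dist (k x) c := by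
  classical
  obtain ⟨M, hM, hKM, hMd⟩ := exists_bound_dist hU (A ∪ X ∪ C) hK
  -- The free amalgam distance truncated at `M`. Truncation keeps it in the distance set and changes
  -- no distance already present.
  have hex : ∀ x c, ∃ r, r ≤ M ∧ (∀ a ∈ A, r ≤ dist x a + dist a c) ∧
      (r = M ∨ ∃ a ∈ A, r = dist x a + dist a c) := by
    intro x c
    obtain ⟨a, ha, hmin⟩ := A.exists_min_image (fun a => dist x a + dist a c) hAne
    refine ⟨min M (dist x a + dist a c), min_le_left _ _,
      fun a' ha' => (min_le_right _ _).trans (hmin a' ha'), ?_⟩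
    rcases min_choice M (dist x a + dist a c) with h | h
    · exact .inl h
    · exact .inr ⟨a, ha, h⟩
  choose ρ hρM hρle hρ using hex
  have hM0 := distanceSet_nonneg hM
  have hρ0 : ∀ x c, 0 ≤ ρ x c := fun x c => by
    rcases hρ x c with h | ⟨a, -, h⟩ <;> rw [h] <;> positivity
  have hmA : ∀ a ∈ A, a ∈ A ∪ X ∪ C := fun a h => by simp [h]
  have hmX : ∀ a ∈ X, a ∈ A ∪ X ∪ C := fun a h => by simp [h]
  have hmC : ∀ a ∈ A ∪ C, a ∈ A ∪ X ∪ C := fun a h => by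
    simp only [Finset.mem_union] at h ⊢; tauto
  obtain ⟨k, hk, hkd⟩ := exists_fixing_of_dist hU A (A ∪ C) X Finset.subset_union_left ρ
    (by
      intro x _ c _
      rcases hρ x c with h | ⟨a, -, h⟩
      · rw [h]; exact hM
      · refine distanceSet_of_le hM ?_ (hρ0 _ _) (hρM _ _)
        rw [h]
        exact S.add_mem (hU.isSbMetric _ _).1 (hU.isSbMetric _ _).1)
    (by
      intro x _ c _ c' _
      rcases hρ x c' with h | ⟨a, ha, h⟩
      · have := hρM x c
        have := dist_nonneg (x := c) (y := c')
        linarith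
      · have := hρle x c a ha
        have := dist_triangle a c' c
        rw [dist_comm c' c] at this
        linarith)
    (by
      intro x _ c hc c' hc'
      rcases hρ x c with h | ⟨a, ha, h⟩
      · have := hMd c (hmC c hc) c' (hmC c' hc')
        have := hρ0 x c'
        linarith
      · rcases hρ x c' with h' | ⟨a', ha', h'⟩
        · have := hMd c (hmC c hc) c' (hmC c' hc')
          have := hρ0 x c
          linarith
        · have h1 := dist_triangle c a c'
          have h2 := dist_triangle a x c'
          have h3 := dist_triangle x a' c'
          rw [dist_comm c a] at h1
          rw [dist_comm a x] at h2
          linarith)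
    (by
      intro x _ x' _ c _
      rcases hρ x' c with h | ⟨a, ha, h⟩
      · have := hρM x c
        have := dist_nonneg (x := x) (y := x')
        linarith
      · have := hρle x c a ha
        have := dist_triangle x x' a
        linarith)
    (by
      intro x hx x' hx' c hc
      rcases hρ x c with h | ⟨a, ha, h⟩
      · have := hMd x (hmX x hx) x' (hmX x' hx')
        have := hρ0 x' c
        linarith
      · rcases hρ x' c with h' | ⟨a', ha', h'⟩
        · have := hMd x (hmX x hx) x' (hmX x' hx')
          have := hρ0 x c
          linarith
        · have h1 := dist_triangle x a x'
          have h2 := dist_triangle a c x'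
          have h3 := dist_triangle x' a' c
          rw [dist_comm c x'] at h2
          linarith)
    (by
      intro x hx a ha
      refine le_antisymm ((hρle x a a ha).trans (by simp)) ?_
      rcases hρ x a with h | ⟨a', ha', h⟩
      · rw [h]; exact hMd x (hmX x hx) a (hmA a ha)
      · rw [h]; exact dist_triangle _ _ _)
  refine ⟨k, hk, fun x hx c hc => ?_⟩
  rw [hkd x hx c (Finset.mem_union_right _ hc)]
  rcases hρ x c with h | ⟨a, ha, h⟩
  · exact .inl (hKM.trans h.ge)
  · exact .inr ⟨a, ha, h.ge⟩

/-- The distances between `p A` and `A` determine the double coset of `p` modulo the pointwise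
stabilizer of `A`: homogeneity extends the map `a ↦ a`, `q a ↦ p a`. -/
theorem exists_fixing_mul_of_dist_eq {S : AddSubgroup ℝ} {b : WithTop ℝ}
    (hU : IsUrysohnSpace S b U) (A : Finset U) (p q : U ≃ᵢ U)
    (h : ∀ a ∈ A, ∀ a' ∈ A, dist (p a) a' = dist (q a) a') :
    ∃ f f' : U ≃ᵢ U, (∀ a ∈ A, f a = a) ∧ (∀ a ∈ A, f' a = a) ∧ p = f * q * f' := by
  obtain ⟨f, hf⟩ := exists_isometryEquiv_of_dist_eq hU
    (Sum.elim (fun a : A => (a : U)) (fun a : A => q a))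
    (Sum.elim (fun a : A => (a : U)) (fun a : A => p a)) (by
      rintro (⟨a, ha⟩ | ⟨a, ha⟩) (⟨a', ha'⟩ | ⟨a', ha'⟩) <;> simp only [Sum.elim_inl, Sum.elim_inr]
      · rw [dist_comm, ← h a' ha' a ha, dist_comm]
      · exact (h a ha a' ha').symm
      · rw [p.dist_eq, q.dist_eq])
  refine ⟨f, q⁻¹ * f⁻¹ * p, fun a ha => hf (.inl ⟨a, ha⟩), fun a ha => ?_, by group⟩
  have : p a = f (q a) := (hf (.inr ⟨a, ha⟩)).symm
  simp [IsometryEquiv.mul_apply, this]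

/-- If `g` moves the finite set `A` far enough from itself, relative to `h`, then `h` is a product of
conjugates by `g` of elements fixing `A` and of elements fixing `A`. -/
theorem exists_eq_mul_conj_fixing {S : AddSubgroup ℝ} {b : WithTop ℝ}
    (hU : IsUrysohnSpace S b U) (A : Finset U) (g h : U ≃ᵢ U)
    (hgh : ∀ x ∈ A, ∀ y ∈ A, ∀ z ∈ A, dist (h x) y ≤ dist x (g z) + dist (g z) y) :
    ∃ f f₁ f₂ f₃ : U ≃ᵢ U, (∀ a ∈ A, f a = a) ∧ (∀ a ∈ A, f₁ a = a) ∧ (∀ a ∈ A, f₂ a = a) ∧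
      (∀ a ∈ A, f₃ a = a) ∧ h = f₁ * (g * f * g⁻¹) * f₂ * (g * f * g⁻¹) * f₃ := by
  classical
  -- If `p` realizes these distances, then `p` and `p⁻¹ * h` have the same distances between the
  -- image of `A` and `A`, so `h` is a product of two elements of one double coset.
  let ρ : U → U → ℝ := fun x c => max (dist x c) (dist (h x) c)
  have hρl : ∀ x c, dist x c ≤ ρ x c := fun x c => le_max_left _ _
  have hρr : ∀ x c, dist (h x) c ≤ ρ x c := fun x c => le_max_right _ _
  have hρD : ∀ x c, ρ x c ∈ distanceSet S b := fun x c =>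
    distanceSet_max (hU.isSbMetric _ _) (hU.isSbMetric _ _)
  have hρ1 : ∀ x c c', ρ x c ≤ ρ x c' + dist c c' := fun x c c' => by
    have h1 := dist_triangle_right x c c'
    have h2 := dist_triangle_right (h x) c c'
    exact max_le (by linarith [hρl x c']) (by linarith [hρr x c'])
  have hρ3 : ∀ x x' c, ρ x c ≤ ρ x' c + dist x x' := fun x x' c => by
    have h1 := dist_triangle x x' c
    have h2 := dist_triangle (h x) (h x') c
    rw [h.dist_eq] at h2
    exact max_le (by linarith [hρl x' c]) (by linarith [hρr x' c])
  obtain ⟨p, -, hp⟩ := exists_fixing_of_dist hU ∅ (A ∪ A.image h) A (Finset.empty_subset _) ρ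
    (fun x _ c _ => hρD x c) (fun x _ c _ c' _ => hρ1 x c c')
    (fun x _ c _ c' _ => by linarith [dist_triangle_left c c' x, hρl x c, hρl x c'])
    (fun x _ x' _ c _ => hρ3 x x' c)
    (fun x _ x' _ c _ => by linarith [dist_triangle_right x x' c, hρl x c, hρl x' c])
    (by simp)
  -- This yields a representative `k` of that double coset fixing `g A`. The hypothesis `hgh`
  -- supplies the triangle inequality through `g A`, and gives `ρ x a = dist x a` where `g A` meets
  -- `A`.
  let σ : U → U → ℝ := fun x c => if c ∈ A then ρ x c else dist x c
  have hσA : ∀ x, ∀ c ∈ A, σ x c = ρ x c := fun x c hc => if_pos hc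
  have hσn : ∀ x, ∀ c, c ∉ A → σ x c = dist x c := fun x c hc => if_neg hc
  have hσl : ∀ x c, dist x c ≤ σ x c := fun x c => by
    by_cases hc : c ∈ A
    · rw [hσA x c hc]; exact hρl x c
    · rw [hσn x c hc]
  have hmem : ∀ c ∈ A.image g ∪ A, c ∉ A → ∃ z ∈ A, g z = c := fun c hc hcA => by
    simpa using (Finset.mem_union.1 hc).resolve_right hcA
  obtain ⟨k, hk, hkd⟩ := exists_fixing_of_dist hU (A.image g) (A.image g ∪ A) A
    Finset.subset_union_left σ
    (fun x _ c _ => by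
      by_cases hc : c ∈ A
      · rw [hσA x c hc]; exact hρD x c
      · rw [hσn x c hc]; exact hU.isSbMetric _ _)
    (fun x hx c hc c' hc' => by
      by_cases h1 : c ∈ A
      · rw [hσA x c h1]
        by_cases h2 : c' ∈ A
        · rw [hσA x c' h2]; exact hρ1 x c c'
        · rw [hσn x c' h2]
          obtain ⟨z, hz, rfl⟩ := hmem c' hc' h2
          refine max_le (dist_triangle_right _ _ _) ?_
          rw [dist_comm c]
          exact hgh x hx c h1 z hz
      · rw [hσn x c h1]
        exact (dist_triangle_right x c c').trans (by linarith [hσl x c']))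
    (fun x _ c _ c' _ => by linarith [dist_triangle_left c c' x, hσl x c, hσl x c'])
    (fun x _ x' _ c _ => by
      by_cases hc : c ∈ A
      · rw [hσA x c hc, hσA x' c hc]; exact hρ3 x x' c
      · rw [hσn x c hc, hσn x' c hc]; linarith [dist_triangle x x' c])
    (fun x _ x' _ c _ => by linarith [dist_triangle_right x x' c, hσl x c, hσl x' c])
    (fun x hx a ha => by
      by_cases hc : a ∈ A
      · rw [hσA x a hc]
        obtain ⟨z, hz, rfl⟩ := Finset.mem_image.1 ha
        refine max_eq_left ?_
        simpa using hgh x hx (g z) hc z hz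
      · exact hσn x a hc)
  have hkA : ∀ x ∈ A, ∀ c ∈ A, dist (k x) c = ρ x c := fun x hx c hc => by
    rw [hkd x hx c (Finset.mem_union_right _ hc), hσA x c hc]
  obtain ⟨f₁, f₁', hf₁, hf₁', hpk⟩ := exists_fixing_mul_of_dist_eq hU A p k (fun a ha a' ha' => by
    rw [hkA a ha a' ha', hp a ha a' (Finset.mem_union_left _ ha')])
  obtain ⟨f₃, f₃', hf₃, hf₃', hpk'⟩ := exists_fixing_mul_of_dist_eq hU A (p⁻¹ * h) k
    (fun a ha a' ha' => by
      rw [hkA a ha a' ha', IsometryEquiv.mul_apply, ← p.dist_eq, IsometryEquiv.apply_inv_self,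
        dist_comm, hp a' ha' (h a) (Finset.mem_union_right _ (Finset.mem_image_of_mem h ha))]
      simp only [ρ]
      rw [h.dist_eq, max_comm, dist_comm a' a, dist_comm a' (h a), max_comm])
  refine ⟨g⁻¹ * k * g, f₁, f₁' * f₃, f₃', fun a ha => ?_, hf₁, fun a ha => ?_, hf₃', ?_⟩
  · rw [IsometryEquiv.mul_apply, IsometryEquiv.mul_apply, hk _ (Finset.mem_image_of_mem g ha),
      IsometryEquiv.inv_apply_self]
  · rw [IsometryEquiv.mul_apply, hf₃ a ha, hf₁' a ha]
  · calc h = p * (p⁻¹ * h) := by group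
      _ = (f₁ * k * f₁') * (f₃ * k * f₃') := by rw [← hpk, ← hpk']
      _ = _ := by group

end Urysohn

/-! ### Group topologies as filters at the identity -/

section GroupFilter

variable {G : Type*} [Group G]

/-- The filters that are the neighbourhood filter of the identity for a group topology. -/
structure IsNhdsOne (N : Filter G) : Prop where
  one_mem : ∀ V ∈ N, (1 : G) ∈ V
  mul : ∀ V ∈ N, ∃ W ∈ N, ∀ x ∈ W, ∀ y ∈ W, x * y ∈ V
  inv : ∀ V ∈ N, {g | g⁻¹ ∈ V} ∈ N
  conj : ∀ h : G, ∀ V ∈ N, {g | h * g * h⁻¹ ∈ V} ∈ N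

theorem IsNhdsOne.exists_list_prod_mem {N : Filter G} (hN : IsNhdsOne N) (n : ℕ) :
    ∀ V ∈ N, ∃ W ∈ N, (∀ w ∈ W, w⁻¹ ∈ W) ∧
      ∀ l : List G, l.length = n → (∀ x ∈ l, x ∈ W) → l.prod ∈ V := by
  induction n with
  | zero =>
    intro V hV
    refine ⟨Set.univ, univ_mem, fun _ _ => trivial, fun l hl _ => ?_⟩
    rw [List.length_eq_zero_iff.1 hl, List.prod_nil]
    exact hN.one_mem V hV
  | succ n ih =>
    intro V hV
    obtain ⟨V₁, hV₁, hmul⟩ := hN.mul V hV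
    obtain ⟨W, hW, hinv, hprod⟩ := ih V₁ hV₁
    refine ⟨W ∩ (V₁ ∩ {g | g⁻¹ ∈ V₁}), inter_mem hW (inter_mem hV₁ (hN.inv _ hV₁)),
      fun w hw => ⟨hinv w hw.1, hw.2.2, by simpa using hw.2.1⟩, fun l hl hlW => ?_⟩
    cases l with
    | nil => simp at hl
    | cons x l =>
      rw [List.prod_cons]
      exact hmul _ (hlW x (by simp)).2.1 _ (hprod l (by simpa using hl)
        fun y hy => (hlW y (by simp [hy])).1)

/-- The generating family is only a subbasis, but each axiom passes to finite intersections and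
supersets. -/
theorem IsNhdsOne.generate {Y : Set (Set G)} (hone : ∀ V ∈ Y, (1 : G) ∈ V)
    (hmul : ∀ V ∈ Y, ∃ W ∈ Filter.generate Y, ∀ x ∈ W, ∀ y ∈ W, x * y ∈ V)
    (hinv : ∀ V ∈ Y, {g | g⁻¹ ∈ V} ∈ Filter.generate Y)
    (hconj : ∀ h : G, ∀ V ∈ Y, {g | h * g * h⁻¹ ∈ V} ∈ Filter.generate Y) :
    IsNhdsOne (Filter.generate Y) where
  one_mem V hV := by
    have : pure (1 : G) ≤ Filter.generate Y := le_generate_iff.2 fun V hV => hone V hV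
    exact this hV
  mul V hV := by
    induction hV with
    | basic h => exact hmul _ h
    | univ => exact ⟨Set.univ, univ_mem, fun _ _ _ _ => trivial⟩
    | superset _ hst ih =>
      obtain ⟨W, hW, h⟩ := ih
      exact ⟨W, hW, fun x hx y hy => hst (h x hx y hy)⟩
    | inter _ _ ih₁ ih₂ =>
      obtain ⟨W₁, hW₁, h₁⟩ := ih₁
      obtain ⟨W₂, hW₂, h₂⟩ := ih₂
      exact ⟨W₁ ∩ W₂, inter_mem hW₁ hW₂,
        fun x hx y hy => ⟨h₁ x hx.1 y hy.1, h₂ x hx.2 y hy.2⟩⟩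
  inv V hV := by
    have : map (fun g : G => g⁻¹) (Filter.generate Y) ≤ Filter.generate Y :=
      le_generate_iff.2 fun V hV => hinv V hV
    exact this hV
  conj h V hV := by
    have : map (fun g : G => h * g * h⁻¹) (Filter.generate Y) ≤ Filter.generate Y :=
      le_generate_iff.2 fun V hV => hconj h V hV
    exact this hV

theorem IsNhdsOne.exists_groupTopology {N : Filter G} (hN : IsNhdsOne N) :
    ∃ τ : GroupTopology G, @nhds G τ.toTopologicalSpace 1 = N := by
  let B : GroupFilterBasis G :=
    { sets := N.sets
      nonempty := ⟨_, univ_mem⟩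
      inter_sets := fun hx hy => ⟨_, inter_mem hx hy, subset_rfl⟩
      one' := fun hV => hN.one_mem _ hV
      mul' := fun hV => by
        obtain ⟨W, hW, h⟩ := hN.mul _ hV
        exact ⟨W, hW, Set.mul_subset_iff.2 h⟩
      inv' := fun hV => ⟨_, hN.inv _ hV, subset_rfl⟩
      conj' := fun h _ hV => ⟨_, hN.conj h _ hV, subset_rfl⟩ }
  refine ⟨⟨B.topology, B.isTopologicalGroup⟩, ?_⟩
  refine (GroupFilterBasis.nhds_one_eq B).trans (Filter.ext fun V => ?_)
  exact ⟨fun ⟨W, hW, hWV⟩ => mem_of_superset hW hWV, fun hV => ⟨V, hV, subset_rfl⟩⟩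

theorem GroupTopology.isNhdsOne (τ : GroupTopology G) :
    IsNhdsOne (@nhds G τ.toTopologicalSpace 1) := by
  let _ := τ.toTopologicalSpace
  have := τ.toIsTopologicalGroup
  refine ⟨fun V hV => mem_of_mem_nhds hV, fun V hV => ?_, fun V hV => ?_, fun h V hV => ?_⟩
  · obtain ⟨W, hW, h1, h⟩ := exists_open_nhds_one_mul_subset hV
    exact ⟨W, hW.mem_nhds h1, fun x hx y hy => h (Set.mul_mem_mul hx hy)⟩
  · have : Tendsto (fun g : G => g⁻¹) (𝓝 1) (𝓝 1) := by simpa using continuous_inv.tendsto (1 : G)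
    exact this hV
  · have hc : Continuous fun g : G => h * g * h⁻¹ := by fun_prop
    have : Tendsto (fun g : G => h * g * h⁻¹) (𝓝 1) (𝓝 1) := by simpa using hc.tendsto 1
    exact this hV

theorem GroupTopology.eq_of_nhds_one {τ τ' : GroupTopology G}
    (h : @nhds G τ.toTopologicalSpace 1 = @nhds G τ'.toTopologicalSpace 1) : τ = τ' :=
  GroupTopology.toTopologicalSpace_injective
    (IsTopologicalGroup.ext τ.toIsTopologicalGroup τ'.toIsTopologicalGroup h)

theorem GroupTopology.le_iff_nhds_one {τ τ' : GroupTopology G} :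
    τ ≤ τ' ↔ @nhds G τ.toTopologicalSpace 1 ≤ @nhds G τ'.toTopologicalSpace 1 := by
  refine ⟨fun h => nhds_mono h, fun h => ?_⟩
  rw [← GroupTopology.toTopologicalSpace_le]
  refine le_of_nhds_le_nhds fun x => ?_
  rw [← @nhds_translation_mul_inv G τ.toTopologicalSpace _ τ.toIsTopologicalGroup x,
    ← @nhds_translation_mul_inv G τ'.toTopologicalSpace _ τ'.toIsTopologicalGroup x]
  exact comap_mono h

end GroupFilter

/-! ### Large displacements and the trivial topology -/

section Coarser

variable {U : Type*} [MetricSpace U]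

theorem dist_apply_left (g : U ≃ᵢ U) (x y : U) : dist (g x) y = dist x (g⁻¹ y) := by
  rw [← g.dist_eq x, IsometryEquiv.apply_inv_self]

/-- Every set of the filter contains the pointwise stabilizer of a finite set. -/
def ContainsStabilizers (N : Filter (U ≃ᵢ U)) : Prop :=
  ∀ V ∈ N, ∃ A : Finset U, ∀ g : U ≃ᵢ U, (∀ a ∈ A, g a = a) → g ∈ V

variable {N : Filter (U ≃ᵢ U)}

/-- Common set-up of the constructions below: `W₁` leaves room for `n` factors, and enlarging `A` to
contain `B` only shrinks its stabilizer. -/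
theorem exists_small_nhds [Nonempty U] (hN : IsNhdsOne N) (hst : ContainsStabilizers N) (n : ℕ)
    {W : Set (U ≃ᵢ U)} (hW : W ∈ N) (B : Finset U) :
    ∃ W₁ ∈ N, (∀ w ∈ W₁, w⁻¹ ∈ W₁) ∧
      (∀ l : List (U ≃ᵢ U), l.length = n → (∀ x ∈ l, x ∈ W₁) → l.prod ∈ W) ∧
      ∃ A : Finset U, B ⊆ A ∧ A.Nonempty ∧ ∀ g : U ≃ᵢ U, (∀ a ∈ A, g a = a) → g ∈ W₁ := by
  classical
  obtain ⟨W₁, hW₁, hinv, hprod⟩ := hN.exists_list_prod_mem n W hW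
  obtain ⟨A, hA⟩ := hst W₁ hW₁
  obtain ⟨u⟩ := ‹Nonempty U›
  exact ⟨W₁, hW₁, hinv, hprod, insert u (A ∪ B), fun x hx => by simp [hx], by simp,
    fun g hg => hA g fun a ha => hg a (by simp [ha])⟩

theorem mem_of_forall_dist_le {S : AddSubgroup ℝ} {b : WithTop ℝ} (hU : IsUrysohnSpace S b U)
    {A : Finset U} {W V : Set (U ≃ᵢ U)} (hinv : ∀ w ∈ W, w⁻¹ ∈ W)
    (hprod : ∀ l : List (U ≃ᵢ U), l.length = 9 → (∀ x ∈ l, x ∈ W) → l.prod ∈ V)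
    (hA : ∀ g : U ≃ᵢ U, (∀ a ∈ A, g a = a) → g ∈ W) {g : U ≃ᵢ U} (hg : g ∈ W) (h : U ≃ᵢ U)
    (hgh : ∀ x ∈ A, ∀ y ∈ A, ∀ z ∈ A, dist (h x) y ≤ dist x (g z) + dist (g z) y) : h ∈ V := by
  obtain ⟨f, f₁, f₂, f₃, hf, hf₁, hf₂, hf₃, rfl⟩ := exists_eq_mul_conj_fixing hU A g h hgh
  have := hprod [f₁, g, f, g⁻¹, f₂, g, f, g⁻¹, f₃] rfl (by
    simp [hA _ hf, hA _ hf₁, hA _ hf₂, hA _ hf₃, hg, hinv _ hg])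
  simpa [mul_assoc] using this

/-- The displacement obtained by moving a finite set over a translate of itself. -/
theorem exists_mem_free_over_image {S : AddSubgroup ℝ} {b : WithTop ℝ}
    (hU : IsUrysohnSpace S b U) {A B : Finset U} {W V : Set (U ≃ᵢ U)} (hinv : ∀ w ∈ W, w⁻¹ ∈ W)
    (hprod : ∀ l : List (U ≃ᵢ U), l.length = 3 → (∀ x ∈ l, x ∈ W) → l.prod ∈ V)
    (hBne : B.Nonempty) (hB : ∀ g : U ≃ᵢ U, (∀ a ∈ B, g a = a) → g ∈ W) {g : U ≃ᵢ U} (hg : g ∈ W)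
    {K : ℝ} (hK : K ∈ distanceSet S b) :
    ∃ k ∈ V, ∀ x ∈ A, ∀ y ∈ A, K ≤ dist (k x) y ∨
      ∃ z ∈ B, dist (g z) x + dist (g z) y ≤ dist (k x) y := by
  classical
  obtain ⟨k, hk, hkd⟩ := exists_fixing_free hU (B.image g) A A (hBne.image g) hK
  refine ⟨k, ?_, fun x hx y hy => (hkd x hx y hy).imp_right fun ⟨a, ha, h⟩ => ?_⟩
  · have hmem : g⁻¹ * k * g ∈ W := hB _ fun a ha => by
      rw [IsometryEquiv.mul_apply, IsometryEquiv.mul_apply, hk _ (Finset.mem_image_of_mem g ha),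
        IsometryEquiv.inv_apply_self]
    have := hprod [g, g⁻¹ * k * g, g⁻¹] rfl (by simp [hg, hinv _ hg, hmem])
    simpa [mul_assoc] using this
  · obtain ⟨z, hz, rfl⟩ := Finset.mem_image.1 ha
    exact ⟨z, hz, by rwa [dist_comm x] at h⟩

theorem exists_isometryEquiv_apply_eq {S : AddSubgroup ℝ} {b : WithTop ℝ} (hU : IsUrysohnSpace S b U)
    (u v : U) : ∃ g : U ≃ᵢ U, g u = v := by
  obtain ⟨g, hg⟩ := exists_isometryEquiv_of_dist_eq hU (fun _ : Unit => u) (fun _ => v) (by simp)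
  exact ⟨g, hg ()⟩

theorem IsNhdsOne.eventually_conj (hN : IsNhdsOne N) (h : U ≃ᵢ U) {P : (U ≃ᵢ U) → Prop}
    (hP : ∀ᶠ g in N, P g) : ∀ᶠ g in N, P (h⁻¹ * g * h) := by
  have := hN.conj h⁻¹ _ hP
  rwa [inv_inv] at this

/-- If `u` is not kept within `ε` of itself, then no point is kept close to a finite set. -/
theorem frequently_lt_dist_of_frequently {S : AddSubgroup ℝ} {b : WithTop ℝ}
    (hU : IsUrysohnSpace S b U) (hN : IsNhdsOne N) {ε δ : ℝ} (hδ : 3 * δ ≤ ε) {u : U}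
    (hu : {g : U ≃ᵢ U | dist (g u) u ≤ ε} ∉ N) (a : U) (B : Finset U) :
    ∃ᶠ g in N, ∀ b' ∈ B, δ < dist (g a) b' := by
  intro hev
  replace hev : ∀ᶠ g in N, ∃ b' ∈ B, dist (g a) b' ≤ δ := hev.mono fun g hg => by
    push Not at hg; exact hg
  have ha : ¬ ∀ᶠ g in N, dist (g a) a ≤ ε := fun hev' => hu <| by
    obtain ⟨h, rfl⟩ := exists_isometryEquiv_apply_eq hU u a
    filter_upwards [hN.eventually_conj h⁻¹ hev'] with g hg
    rw [← h.dist_eq]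
    simpa [IsometryEquiv.mul_apply] using hg
  -- Pigeonhole: finitely many eventual properties hold together eventually.
  obtain ⟨c, hc, hfr⟩ : ∃ c ∈ B, ∃ᶠ g in N, ε < dist (g a) a ∧ dist (g a) c ≤ δ := by
    by_contra! hcon
    refine ha ?_
    have : ∀ᶠ g in N, ∀ c ∈ B, ¬ (ε < dist (g a) a ∧ dist (g a) c ≤ δ) :=
      (eventually_all_finset B).2 fun c hc => by simpa using hcon c hc
    filter_upwards [this, hev] with g h1 ⟨c, hc, h2⟩
    by_contra! h3
    exact h1 c hc ⟨h3, h2⟩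
  have hac : ε - δ < dist c a := by
    obtain ⟨g, h1, h2⟩ := hfr.exists
    have := dist_triangle (g a) c a
    linarith
  -- As `k` fixes `a`, the conjugate of `g` by `k` sends `a` to `k (g a)`, which is within `δ` both
  -- of `k c` and of some `c' ∈ B`. But `k c` is at least `d(c, a) > ε - δ ≥ 2δ` away from `B`.
  obtain ⟨k, hk, hkd⟩ := exists_fixing_free hU {a} {c} B (by simp) (hU.isSbMetric c a)
  have hka : k⁻¹ a = a := by
    conv_lhs => rw [← hk a (by simp)]
    simp
  obtain ⟨g, ⟨hg1, hg2⟩, ⟨c', hc', hg3⟩⟩ :=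
    (hfr.and_eventually (hN.eventually_conj k⁻¹ hev)).exists
  have hd : dist (k c) c' ≤ 2 * δ := by
    have h1 : dist (k (g a)) (k c) ≤ δ := by rwa [k.dist_eq]
    have h2 : dist (k (g a)) c' ≤ δ := by simpa [IsometryEquiv.mul_apply, hka] using hg3
    have := dist_triangle_left (k c) c' (k (g a))
    linarith
  rcases hkd c (by simp) c' hc' with h | ⟨z, hz, h⟩
  · linarith
  · rw [Finset.mem_singleton.1 hz] at h
    have := dist_nonneg (x := a) (y := c')
    linarith

/-- If `g₁` moves `A` well but leaves `g₁ a` within `δ` of some `c ∈ B`, then a further `g₂` carries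
`c`, and with it `g₁ a`, away from `B`. A map `k` fixing `c`, inserted in between, prevents `g₂`
from bringing the images of `A` back. The factor 2 pays for the distance from `g₁ a` to `c`. -/
theorem frequently_forall_lt_dist [Nonempty U] {S : AddSubgroup ℝ} {b : WithTop ℝ}
    (hU : IsUrysohnSpace S b U) (hN : IsNhdsOne N) (hst : ContainsStabilizers N) {δ : ℝ}
    (hδ : 0 ≤ δ) (h : ∀ (a : U) (B : Finset U), ∃ᶠ g in N, ∀ b' ∈ B, 2 * δ < dist (g a) b')
    (A B : Finset U) : ∃ᶠ g in N, ∀ a ∈ A, ∀ b' ∈ B, δ < dist (g a) b' := by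
  classical
  induction A using Finset.induction_on generalizing B with
  | empty =>
    obtain ⟨u⟩ := ‹Nonempty U›
    exact (h u ∅).mono fun g _ => by simp
  | insert a A _ ih =>
    refine frequently_iff.2 fun {W} hW => ?_
    obtain ⟨W₁, hW₁, hinv, hprod, A₁, hBA, hne, hA₁⟩ := exists_small_nhds hN hst 3 hW B
    obtain ⟨g₁, hg₁, hg₁d⟩ := frequently_iff.1 (ih A₁) hW₁
    by_cases hgood : ∀ b' ∈ B, δ < dist (g₁ a) b'
    · refine ⟨g₁, ?_, fun x hx => ?_⟩
      · have h1 := hA₁ 1 (by simp)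
        simpa using hprod [g₁, 1, 1] rfl (by simp [hg₁, h1])
      · rcases Finset.mem_insert.1 hx with rfl | hx
        · exact hgood
        · exact fun b' hb' => hg₁d x hx b' (hBA hb')
    push Not at hgood
    obtain ⟨c, hc, hcd⟩ := hgood
    obtain ⟨g₂, hg₂, hg₂d⟩ := frequently_iff.1 (h c B) hW₁
    -- The cap `dist (g₂ c) c` is chosen only because it exceeds `2 * δ`.
    obtain ⟨k, hk, hkd⟩ := exists_fixing_free hU A₁ (A.image g₁) (B.image ⇑g₂⁻¹) hne
      (hU.isSbMetric (g₂ c) c)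
    refine ⟨g₂ * k * g₁, ?_, fun x hx b' hb' => ?_⟩
    · simpa [mul_assoc] using hprod [g₂, k, g₁] rfl (by simp [hg₁, hg₂, hA₁ k hk])
    · rw [IsometryEquiv.mul_apply, IsometryEquiv.mul_apply]
      rcases Finset.mem_insert.1 hx with rfl | hx
      · have h1 := dist_triangle_left (g₂ c) b' (g₂ (k (g₁ x)))
        have h2 : dist (g₂ (k (g₁ x))) (g₂ c) ≤ δ := by
          rw [g₂.dist_eq]
          conv_lhs => rw [← hk c (hBA hc)]
          rwa [k.dist_eq]
        linarith [hg₂d b' hb']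
      · rw [dist_apply_left]
        rcases hkd (g₁ x) (Finset.mem_image_of_mem _ hx) (g₂⁻¹ b')
          (Finset.mem_image_of_mem _ hb') with h1 | ⟨z, hz, h1⟩
        · linarith [hg₂d c hc]
        · linarith [hg₁d x hx z hz, dist_nonneg (x := z) (y := g₂⁻¹ b')]

/-- A filter for which displacements are not eventually small is trivial. -/
theorem eq_univ_of_not_small [Nonempty U] {S : AddSubgroup ℝ} {b : WithTop ℝ}
    (hU : IsUrysohnSpace S b U) (hN : IsNhdsOne N) (hst : ContainsStabilizers N) {ε : ℝ}
    (hε : 0 < ε) {u : U} (hu : {g : U ≃ᵢ U | dist (g u) u ≤ ε} ∉ N)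
    {V : Set (U ≃ᵢ U)} (hV : V ∈ N) : V = Set.univ := by
  -- The 6 is a factor 3 for one point times a factor 2 for passing to a finite set.
  have hbase : ∀ A : Finset U, ∃ᶠ g in N, ∀ a ∈ A, ∀ a' ∈ A, ε / 6 ≤ dist (g a) a' := fun A =>
    (frequently_forall_lt_dist hU hN hst (by positivity)
      (frequently_lt_dist_of_frequently hU hN (by linarith) hu) A A).mono
      fun g hg a ha a' ha' => (hg a ha a' ha').le
  -- Free amalgamation over `g B` doubles the displacement up to the cap `R`. The set `A` must vary,
  -- as `B` is larger.
  have hdouble : ∀ R ∈ distanceSet S b, ∀ n : ℕ, ∀ A : Finset U,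
      ∃ᶠ g in N, ∀ a ∈ A, ∀ a' ∈ A, min (2 ^ n * (ε / 6)) R ≤ dist (g a) a' := by
    intro R hR n
    induction n with
    | zero =>
      exact fun A => (hbase A).mono fun g hg a ha a' ha' =>
        (min_le_left _ _).trans (by simpa using hg a ha a' ha')
    | succ n ih =>
      intro A
      refine frequently_iff.2 fun {W} hW => ?_
      obtain ⟨W₁, hW₁, hinv, hprod, B, hAB, hne, hB⟩ := exists_small_nhds hN hst 3 hW A
      obtain ⟨g, hg, hgd⟩ := frequently_iff.1 (ih B) hW₁
      obtain ⟨k, hk, hkd⟩ := exists_mem_free_over_image (A := A) hU hinv hprod hne hB hg hR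
      refine ⟨k, hk, fun x hx y hy => ?_⟩
      rcases hkd x hx y hy with h | ⟨z, hz, h⟩
      · exact (min_le_right _ _).trans h
      · have h1 := hgd z hz x (hAB hx)
        have h2 := hgd z hz y (hAB hy)
        have h3 := distanceSet_nonneg hR
        rcases min_cases (2 ^ n * (ε / 6)) R with ⟨h4, -⟩ | ⟨h4, -⟩
        · refine (min_le_left _ _).trans ?_
          rw [pow_succ]
          linarith
        · refine (min_le_right _ _).trans ?_
          linarith
  refine Set.eq_univ_of_forall fun h => ?_
  classical
  obtain ⟨W₁, hW₁, hinv, hprod, A, -, ⟨a₀, -⟩, hA⟩ := exists_small_nhds hN hst 9 hV ∅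
  obtain ⟨R, hR, -, hRd⟩ := exists_bound_dist hU (A ∪ A.image h) (hU.isSbMetric a₀ a₀)
  obtain ⟨n, hn⟩ := pow_unbounded_of_one_lt (R / (ε / 6)) (one_lt_two)
  rw [div_lt_iff₀ (by positivity)] at hn
  obtain ⟨g, hg, hgd⟩ := frequently_iff.1 (hdouble R hR n A) hW₁
  rw [min_eq_right hn.le] at hgd
  refine mem_of_forall_dist_le hU hinv hprod hA hg h fun x hx y hy z hz => ?_
  have h1 := hRd (h x) (by simp [hx]) y (by simp [hy])
  have h2 := hgd z hz y hy
  have h3 := dist_nonneg (x := x) (y := g z)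
  linarith

end Coarser

/-! ### Between the stabilizer, spherical and metric topologies -/

section Spherical

variable {U : Type*} [MetricSpace U] {N : Filter (U ≃ᵢ U)}

/-- A filter not containing some point stabilizer is coarser than the filter generated by the
spherical sets. -/
theorem mem_of_stabilizer_notMem [Nonempty U] {S : AddSubgroup ℝ} {b : WithTop ℝ}
    (hU : IsUrysohnSpace S b U) (hN : IsNhdsOne N) (hst : ContainsStabilizers N) {u : U}
    (hu : {g : U ≃ᵢ U | g u = u} ∉ N) {N' : Filter (U ≃ᵢ U)}
    (hsph : ∀ x y : U, 0 < dist x y → {g : U ≃ᵢ U | dist (g x) y ≤ dist x y} ∈ N')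
    (hm : ∀ (x : U) (ε : ℝ), 0 < ε → {g : U ≃ᵢ U | dist (g x) x ≤ ε} ∈ N')
    {V : Set (U ≃ᵢ U)} (hV : V ∈ N) : V ∈ N' := by
  have hu' : {g : U ≃ᵢ U | dist (g u) u ≤ 0} ∉ N := by simpa using hu
  obtain ⟨W₁, hW₁, hinv, hprod, A, -, -, hA⟩ := exists_small_nhds hN hst 9 hV ∅
  obtain ⟨g, hg, hgd⟩ := frequently_iff.1 (frequently_forall_lt_dist hU hN hst le_rfl
    (frequently_lt_dist_of_frequently hU hN (by simp) hu') A A) hW₁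
  -- For `x = y` the right side is positive since `g` moves `A` off itself; for `x ≠ y` it is at
  -- least `dist x y`.
  have : ∀ᶠ h in N', ∀ x ∈ A, ∀ y ∈ A, ∀ z ∈ A, dist (h x) y ≤ dist x (g z) + dist (g z) y := by
    simp_rw [eventually_all_finset]
    intro x hx y hy z hz
    by_cases hxy : x = y
    · subst hxy
      exact hm x _ (add_pos_of_nonneg_of_pos dist_nonneg (hgd z hz x hx))
    · filter_upwards [hsph x y (dist_pos.2 hxy)] with h hh
      exact le_trans hh (dist_triangle _ _ _)
  filter_upwards [this] with h hh
  exact mem_of_forall_dist_le hU hinv hprod hA hg h hh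

theorem tendsto_apply_of_mem (hm : ∀ (x : U) (ε : ℝ), 0 < ε → {g : U ≃ᵢ U | dist (g x) x ≤ ε} ∈ N)
    (x : U) : Tendsto (fun g : U ≃ᵢ U => g x) N (𝓝 x) := by
  refine Metric.tendsto_nhds.2 fun ε hε => ?_
  filter_upwards [hm x (ε / 2) (by positivity)] with g hg
  exact lt_of_le_of_lt hg (by linarith)

/-- If the distance of the image of `u` to `v` may increase, then a point may be moved away from
all points of a finite set that are near to it. -/
theorem frequently_lt_dist_of_spherical_notMem {S : AddSubgroup ℝ} {b : WithTop ℝ}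
    (hU : IsUrysohnSpace S b U) (hN : IsNhdsOne N) {u v : U}
    (huv : {g : U ≃ᵢ U | dist (g u) v ≤ dist u v} ∉ N) (a : U) (B : Finset U) :
    ∃ᶠ g in N, ∀ c ∈ B, c ≠ a → dist a c ≤ dist u v / 2 → dist a c < dist (g a) c := by
  classical
  intro hev
  replace hev : ∀ᶠ g in N, ∃ c ∈ B, c ≠ a ∧ dist a c ≤ dist u v / 2 ∧ dist (g a) c ≤ dist a c :=
    hev.mono fun g hg => by push Not at hg; exact hg
  obtain ⟨h, rfl⟩ := exists_isometryEquiv_apply_eq hU u a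
  have hr : dist (h u) (h v) = dist u v := h.dist_eq u v
  refine huv ?_
  suffices hsuff : ∀ᶠ g in N, dist (g (h u)) (h v) ≤ dist u v by
    filter_upwards [hN.eventually_conj h⁻¹ hsuff] with g hg
    rw [← h.dist_eq]
    simpa [IsometryEquiv.mul_apply] using hg
  generalize h u = a at *
  generalize h v = w at *
  rw [← hr] at hev ⊢
  clear hr huv
  let X := B.filter fun c => dist a c ≤ dist a w / 2
  have hX : ∀ x ∈ X, dist x a ≤ dist a w / 2 := fun x hx => by
    rw [dist_comm]; exact (Finset.mem_filter.1 hx).2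
  have hw0 : 0 ≤ dist a w := dist_nonneg
  -- Each `x ∈ X` is put on a segment from `a` to `w`, which `d(x, a) ≤ d(a, w) / 2` makes
  -- consistent. If then `d(g a, k c) ≤ d(a, c)`, the triangle inequality through `k c` gives `d(g
  -- a, w) ≤ d(a, w)`.
  let ρ : U → U → ℝ := fun x c => if c = a then dist x a else dist a w - dist x a
  have hρa : ∀ x, ρ x a = dist x a := fun x => if_pos rfl
  have hρ : ∀ x ∈ X, ∀ c ∈ ({a, w} : Finset U),
      (c = a ∧ ρ x c = dist x a) ∨ (c = w ∧ ρ x c = dist a w - dist x a) := fun x _ c hc => by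
    by_cases hca : c = a
    · exact .inl ⟨hca, if_pos hca⟩
    · exact .inr ⟨by simpa [hca] using hc, if_neg hca⟩
  obtain ⟨k, hk, hkd⟩ := exists_fixing_of_dist hU {a} {a, w} X (by simp) ρ
    (fun x hx c hc => by
      have := hX x hx
      rcases hρ x hx c hc with ⟨-, h⟩ | ⟨-, h⟩
      · rw [h]; exact hU.isSbMetric _ _
      · rw [h]
        exact distanceSet_of_le (hU.isSbMetric a w)
          (S.sub_mem (hU.isSbMetric _ _).1 (hU.isSbMetric _ _).1) (by linarith)
          (by linarith [dist_nonneg (x := x) (y := a)]))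
    (fun x hx c hc c' hc' => by
      have := hX x hx
      have := dist_nonneg (x := x) (y := a)
      rcases hρ x hx c hc with ⟨h1, h⟩ | ⟨h1, h⟩ <;> rcases hρ x hx c' hc' with ⟨h2, h'⟩ | ⟨h2, h'⟩ <;>
        rw [h, h', h1, h2] <;> (try rw [dist_self]) <;> (try rw [dist_comm w a]) <;> linarith)
    (fun x hx c hc c' hc' => by
      have := hX x hx
      have := dist_nonneg (x := x) (y := a)
      rcases hρ x hx c hc with ⟨h1, h⟩ | ⟨h1, h⟩ <;> rcases hρ x hx c' hc' with ⟨h2, h'⟩ | ⟨h2, h'⟩ <;>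
        rw [h, h', h1, h2] <;> (try rw [dist_self]) <;> (try rw [dist_comm w a]) <;> linarith)
    (fun x hx x' hx' c hc => by
      have h3 := dist_triangle x x' a
      have h4 := dist_triangle_left x' a x
      rcases hρ x hx c hc with ⟨h1, h⟩ | ⟨h1, h⟩ <;> rcases hρ x' hx' c hc with ⟨h2, h'⟩ | ⟨h2, h'⟩
      · linarith
      · have haw : dist a w = 0 := by rw [← h2, h1, dist_self]
        linarith [hX x hx, dist_nonneg (x := x) (y := x'), dist_nonneg (x := x') (y := a)]
      · have haw : dist a w = 0 := by rw [← h1, h2, dist_self]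
        linarith [dist_nonneg (x := x) (y := x'), dist_nonneg (x := x) (y := a),
          dist_nonneg (x := x') (y := a)]
      · linarith)
    (fun x hx x' hx' c hc => by
      have h3 := dist_triangle_right x x' a
      have h5 := hX x hx
      have h6 := hX x' hx'
      rcases hρ x hx c hc with ⟨h1, h⟩ | ⟨h1, h⟩ <;> rcases hρ x' hx' c hc with ⟨h2, h'⟩ | ⟨h2, h'⟩ <;>
        linarith)
    (fun x hx c hc => by rw [Finset.mem_singleton.1 hc]; exact hρa x)
  have hka : k a = a := hk a (by simp)
  filter_upwards [hN.eventually_conj k hev] with g ⟨c, hcB, hca, hcr, hcd⟩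
  have hcX : c ∈ X := Finset.mem_filter.2 ⟨hcB, hcr⟩
  have h1 : dist (g a) (k c) ≤ dist a c := by
    rw [dist_comm, dist_apply_left, dist_comm]
    simpa [IsometryEquiv.mul_apply, hka] using hcd
  have h2 : dist (k c) w = dist a w - dist c a := by
    rw [hkd c hcX w (by simp)]
    rcases hρ c hcX w (by simp) with ⟨h3, h4⟩ | ⟨-, h4⟩
    · exfalso
      rw [h3, dist_self] at hcr
      exact hca (dist_le_zero.1 (by rw [dist_comm]; linarith))
    · exact h4
  have := dist_triangle (g a) (k c) w
  rw [dist_comm c a] at h2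
  linarith

/-- A finite set may be moved off all metric segments between near points of a finite set. -/
theorem frequently_off_segments [Nonempty U] {S : AddSubgroup ℝ} {b : WithTop ℝ}
    (hU : IsUrysohnSpace S b U) (hN : IsNhdsOne N) (hst : ContainsStabilizers N)
    (hm : ∀ (x : U) (ε : ℝ), 0 < ε → {g : U ≃ᵢ U | dist (g x) x ≤ ε} ∈ N)
    {r : ℝ} (hr : r ∈ distanceSet S b) {ρ : ℝ} (hρr : ρ < r)
    (hnear : ∀ a : U, ∃ c, c ≠ a ∧ dist a c ≤ ρ)
    (h : ∀ (a : U) (B : Finset U), ∃ᶠ g in N, ∀ c ∈ B, c ≠ a → dist a c ≤ ρ →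
      dist a c < dist (g a) c)
    (L A : Finset U) : ∃ᶠ g in N, ∀ l ∈ L, ∀ x ∈ A, ∀ y ∈ A, dist x y ≤ ρ →
      dist x y < dist (g l) x + dist (g l) y := by
  classical
  have hsingle : ∀ (l : U) (A : Finset U), ∃ᶠ g in N, ∀ x ∈ A, ∀ y ∈ A, dist x y ≤ ρ →
      dist x y < dist (g l) x + dist (g l) y := by
    intro l A
    -- The point `e` serves only the degenerate segment `x = y = l`: a strict increase of the
    -- distance to `e` forces `g l ≠ l`.
    obtain ⟨e, hel, hed⟩ := hnear l
    -- Being off a segment persists under small displacements, so only segments through `l` need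
    -- `h`.
    have hev : ∀ᶠ g in N, ∀ x ∈ A, ∀ y ∈ A, dist x y < dist l x + dist l y →
        dist x y < dist (g l) x + dist (g l) y := by
      simp_rw [eventually_all_finset]
      intro x _ y _
      by_cases hlt : dist x y < dist l x + dist l y
      · have ht := tendsto_apply_of_mem hm l
        exact (((ht.dist tendsto_const_nhds).add (ht.dist tendsto_const_nhds)).eventually_const_lt
          hlt).mono fun g hg _ => hg
      · exact Eventually.of_forall fun g h => absurd h hlt
    refine ((h l (insert e A)).and_eventually hev).mono fun g ⟨h1, h2⟩ x hx y hy hxy => ?_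
    by_cases hlt : dist x y < dist l x + dist l y
    · exact h2 x hx y hy hlt
    have hxyl := dist_triangle_left x y l
    have hlx0 := dist_nonneg (x := l) (y := x)
    have hly0 := dist_nonneg (x := l) (y := y)
    have hglx := dist_nonneg (x := g l) (y := x)
    have hgly := dist_nonneg (x := g l) (y := y)
    by_cases hxl : x = l
    · by_cases hyl : y = l
      · subst hxl
        subst hyl
        have h3 := h1 e (by simp) hel hed
        have : g y ≠ y := fun h4 => by rw [h4] at h3; exact lt_irrefl _ h3
        have := dist_pos.2 this
        rw [dist_self]
        linarith
      · have := h1 y (by simp [hy]) hyl (by linarith)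
        rw [hxl] at hglx ⊢
        linarith
    · have h3 := h1 x (by simp [hx]) hxl (by linarith)
      by_cases hyl : y = l
      · rw [hyl] at hgly ⊢
        rw [dist_comm x l]
        linarith
      · have := h1 y (by simp [hy]) hyl (by linarith)
        linarith
  induction L using Finset.induction_on generalizing A with
  | empty =>
    obtain ⟨u⟩ := ‹Nonempty U›
    exact (hsingle u ∅).mono fun g _ => by simp
  | insert l L _ ih =>
    refine frequently_iff.2 fun {W} hW => ?_
    obtain ⟨W₁, hW₁, hinv, hprod, B, hAB, hne, hB⟩ := exists_small_nhds hN hst 3 hW (insert l A)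
    obtain ⟨g₂, hg₂, hg₂d⟩ := frequently_iff.1 (hsingle l A) hW₁
    -- The displacement of `l` by `g₁` must be smaller than the margin by which `g₂ l` is off the
    -- segments.
    have hev : ∀ᶠ g in N, ∀ x ∈ A, ∀ y ∈ A, dist x y ≤ ρ →
        dist x y < (dist (g₂ l) x - dist (g l) l) + (dist (g₂ l) y - dist (g l) l) := by
      simp_rw [eventually_all_finset]
      intro x hx y hy
      by_cases hxy : dist x y ≤ ρ
      · have ht : Tendsto (fun g : U ≃ᵢ U => dist (g l) l) N (𝓝 0) := by
          simpa using (tendsto_apply_of_mem hm l).dist (tendsto_const_nhds (x := l))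
        have ht2 : Tendsto (fun g : U ≃ᵢ U => (dist (g₂ l) x - dist (g l) l) +
            (dist (g₂ l) y - dist (g l) l)) N (𝓝 (dist (g₂ l) x - 0 + (dist (g₂ l) y - 0))) :=
          (tendsto_const_nhds.sub ht).add (tendsto_const_nhds.sub ht)
        exact (ht2.eventually_const_lt (by simpa using hg₂d x hx y hy hxy)).mono fun g hg _ => hg
      · exact Eventually.of_forall fun g h => absurd h hxy
    obtain ⟨g₁, hg₁, hg₁d, hg₁n⟩ := frequently_iff.1 ((ih B).and_eventually hev) hW₁
    obtain ⟨k, hk, hkd⟩ := exists_fixing_free hU B (L.image g₁) (A.image ⇑g₂⁻¹) hne hr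
    refine ⟨g₂ * k * g₁, ?_, fun p hp x hx y hy hxy => ?_⟩
    · simpa [mul_assoc] using hprod [g₂, k, g₁] rfl (by simp [hg₁, hg₂, hB k hk])
    rw [IsometryEquiv.mul_apply, IsometryEquiv.mul_apply]
    rcases Finset.mem_insert.1 hp with rfl | hp
    · have h1 : dist (g₂ (k (g₁ p))) (g₂ p) = dist (g₁ p) p := by
        rw [g₂.dist_eq]
        have := k.dist_eq (g₁ p) p
        rwa [hk p (hAB (by simp))] at this
      have h2 := dist_triangle_left (g₂ p) x (g₂ (k (g₁ p)))
      have h3 := dist_triangle_left (g₂ p) y (g₂ (k (g₁ p)))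
      have := hg₁n x hx y hy hxy
      linarith
    · rw [dist_apply_left, dist_apply_left g₂ _ y]
      have hx0 := dist_nonneg (x := k (g₁ p)) (y := g₂⁻¹ x)
      have hy0 := dist_nonneg (x := k (g₁ p)) (y := g₂⁻¹ y)
      rcases hkd _ (Finset.mem_image_of_mem _ hp) _ (Finset.mem_image_of_mem _ hx) with
        h1 | ⟨z, hz, h1⟩
      · linarith
      rcases hkd _ (Finset.mem_image_of_mem _ hp) _ (Finset.mem_image_of_mem _ hy) with
        h2 | ⟨z', hz', h2⟩
      · linarith
      have hz0 := dist_nonneg (x := z) (y := g₂⁻¹ x)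
      have hz0' := dist_nonneg (x := z') (y := g₂⁻¹ y)
      -- Either `g₁ p` is off the segment from `z` to `z'`, or `d(z, z')` already exceeds `ρ ≥ d(x,
      -- y)`.
      by_cases hzz : dist z z' ≤ ρ
      · have h3 := hg₁d p hp z hz z' hz' hzz
        have h4 : dist (g₂⁻¹ x) (g₂⁻¹ y) = dist x y := g₂⁻¹.dist_eq x y
        have h5 := dist_triangle4 (g₂⁻¹ x) z z' (g₂⁻¹ y)
        rw [dist_comm _ z] at h5
        linarith
      · have := dist_triangle_left z z' (g₁ p)
        linarith

/-- A finite set may be moved so that no distance to itself decreases and all distances up to `σ`,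
where `σ` is not maximal, strictly increase. -/
theorem frequently_expand [Nonempty U] {S : AddSubgroup ℝ} {b : WithTop ℝ}
    (hU : IsUrysohnSpace S b U) (hN : IsNhdsOne N) (hst : ContainsStabilizers N)
    {r : ℝ} (hr : r ∈ distanceSet S b) {ρ : ℝ} (hρ : 0 < ρ) (hρr : ρ < r)
    (h : ∀ L A : Finset U, ∃ᶠ g in N, ∀ l ∈ L, ∀ x ∈ A, ∀ y ∈ A, dist x y ≤ ρ →
      dist x y < dist (g l) x + dist (g l) y)
    {K σ : ℝ} (hK : K ∈ distanceSet S b) (hσK : σ < K) (hσ : 0 ≤ σ) (A : Finset U) :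
    ∃ᶠ g in N, ∀ x ∈ A, ∀ y ∈ A, dist x y ≤ dist (g x) y ∧
      (dist x y ≤ σ → dist x y < dist (g x) y) := by
  -- The threshold doubles: along `x, z, y`, either one of the two distances is below the old
  -- threshold and strictly increases, or both exceed it and their sum exceeds `d(x, y)`.
  have hdouble : ∀ n : ℕ, ∀ A : Finset U, ∃ᶠ g in N, ∀ x ∈ A, ∀ y ∈ A,
      dist x y ≤ dist (g x) y ∧ (dist x y ≤ min (2 ^ n * ρ) σ → dist x y < dist (g x) y) := by
    intro n
    induction n with
    | zero =>
      intro A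
      refine frequently_iff.2 fun {W} hW => ?_
      obtain ⟨W₁, hW₁, hinv, hprod, B, hAB, hne, hB⟩ := exists_small_nhds hN hst 3 hW A
      obtain ⟨g, hg, hgd⟩ := frequently_iff.1 (h B A) hW₁
      obtain ⟨M, hM, hrM, hMd⟩ := exists_bound_dist hU A hr
      obtain ⟨k, hk, hkd⟩ := exists_mem_free_over_image (A := A) hU hinv hprod hne hB hg hM
      refine ⟨k, hk, fun x hx y hy => ?_⟩
      rcases hkd x hx y hy with h1 | ⟨z, hz, h1⟩
      · exact ⟨(hMd x hx y hy).trans h1, fun h2 => by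
          linarith [h2.trans (min_le_left _ _), pow_zero (2 : ℝ)]⟩
      · exact ⟨(dist_triangle_left _ _ _).trans h1, fun h2 =>
          (hgd z hz x hx y hy (by simpa using h2.trans (min_le_left _ _))).trans_le h1⟩
    | succ n ih =>
      intro A
      refine frequently_iff.2 fun {W} hW => ?_
      obtain ⟨W₁, hW₁, hinv, hprod, B, hAB, hne, hB⟩ := exists_small_nhds hN hst 3 hW A
      obtain ⟨g, hg, hgd⟩ := frequently_iff.1 (ih B) hW₁
      obtain ⟨M, hM, hKM, hMd⟩ := exists_bound_dist hU A hK
      obtain ⟨k, hk, hkd⟩ := exists_mem_free_over_image (A := A) hU hinv hprod hne hB hg hM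
      refine ⟨k, hk, fun x hx y hy => ?_⟩
      rcases hkd x hx y hy with h1 | ⟨z, hz, h1⟩
      · exact ⟨(hMd x hx y hy).trans h1, fun h2 => by linarith [h2.trans (min_le_right _ _)]⟩
      · obtain ⟨h3, h3'⟩ := hgd z hz x (hAB hx)
        obtain ⟨h4, h4'⟩ := hgd z hz y (hAB hy)
        have h5 := dist_triangle_left x y z
        refine ⟨by linarith, fun h2 => ?_⟩
        by_cases h6 : dist z x ≤ min (2 ^ n * ρ) σ
        · linarith [h3' h6]
        by_cases h7 : dist z y ≤ min (2 ^ n * ρ) σ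
        · linarith [h4' h7]
        have h8 := h2.trans (min_le_left _ _)
        have h9 := h2.trans (min_le_right _ _)
        rw [pow_succ] at h8
        rcases min_cases (2 ^ n * ρ) σ with ⟨h10, -⟩ | ⟨h10, -⟩ <;> rw [h10] at h6 h7 <;> linarith
  obtain ⟨n, hn⟩ := pow_unbounded_of_one_lt (σ / ρ) (one_lt_two)
  rw [div_lt_iff₀ hρ] at hn
  have := hdouble n A
  rwa [min_eq_right hn.le] at this

/-- For finite `b` the distance `b` cannot increase, so it has to be set apart; `K` shows that `σ`
can still be exceeded. -/
theorem exists_bound_dist_of_not_maximal {S : AddSubgroup ℝ} {b : WithTop ℝ}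
    (hpos : ∃ r ∈ distanceSet S b, 0 < r) (T : Finset ℝ) (hT : ∀ t ∈ T, t ∈ distanceSet S b) :
    ∃ σ, 0 ≤ σ ∧ (∃ K ∈ distanceSet S b, σ < K) ∧
      ∀ t ∈ T, t ≤ σ ∨ ∀ s ∈ distanceSet S b, s ≤ t := by
  classical
  induction T using Finset.induction_on with
  | empty => exact ⟨0, le_rfl, hpos, by simp⟩
  | insert t T _ ih =>
    obtain ⟨σ, h0, ⟨K, hK, hσK⟩, hσ⟩ := ih fun s hs => hT s (by simp [hs])
    by_cases hmax : ∀ s ∈ distanceSet S b, s ≤ t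
    · refine ⟨σ, h0, ⟨K, hK, hσK⟩, fun s hs => ?_⟩
      rcases Finset.mem_insert.1 hs with rfl | hs
      exacts [.inr hmax, hσ s hs]
    · push Not at hmax
      obtain ⟨s, hs, hts⟩ := hmax
      refine ⟨max σ t, le_max_of_le_left h0, ⟨max K s, distanceSet_max hK hs,
        max_lt_max hσK hts⟩, fun t' ht' => ?_⟩
      rcases Finset.mem_insert.1 ht' with rfl | ht'
      · exact .inl (le_max_right _ _)
      · exact (hσ t' ht').imp_left le_max_of_le_left

/-- A filter not containing some spherical set is coarser than the filter generated by the metric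
neighbourhoods. -/
theorem mem_of_spherical_notMem [Nonempty U] {S : AddSubgroup ℝ} (hS : Dense (S : Set ℝ))
    {b : WithTop ℝ} (hb : b = ⊤ ∨ ∃ c : ℝ, c ∈ S ∧ 0 < c ∧ b = (c : WithTop ℝ))
    (hU : IsUrysohnSpace S b U) (hN : IsNhdsOne N) (hst : ContainsStabilizers N)
    (hm : ∀ (x : U) (ε : ℝ), 0 < ε → {g : U ≃ᵢ U | dist (g x) x ≤ ε} ∈ N)
    {u v : U} (h0 : 0 < dist u v) (huv : {g : U ≃ᵢ U | dist (g u) v ≤ dist u v} ∉ N)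
    {N' : Filter (U ≃ᵢ U)}
    (hm' : ∀ (x : U) (ε : ℝ), 0 < ε → {g : U ≃ᵢ U | dist (g x) x ≤ ε} ∈ N')
    {V : Set (U ≃ᵢ U)} (hV : V ∈ N) : V ∈ N' := by
  classical
  have hnear : ∀ a : U, ∃ c, c ≠ a ∧ dist a c ≤ dist u v / 2 := fun a => by
    obtain ⟨r, hr, hr0, hrle⟩ := distanceSet_exists_pos_le hS hb (half_pos h0)
    obtain ⟨k, -, hk⟩ := exists_fixing_of_dist hU ∅ {a} {a} (by simp) (fun _ _ => r)
      (fun _ _ _ _ => hr) (by simp) (by simp [hr0.le]) (by simp) (by simp [hr0.le]) (by simp)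
    have := hk a (by simp) a (by simp)
    exact ⟨k a, dist_pos.1 (by rwa [this]), by rwa [dist_comm, this]⟩
  have hoff := frequently_off_segments hU hN hst hm (hU.isSbMetric u v) (half_lt_self h0) hnear
    (frequently_lt_dist_of_spherical_notMem hU hN huv)
  obtain ⟨W₁, hW₁, hinv, hprod, A, -, -, hA⟩ := exists_small_nhds hN hst 9 hV ∅
  obtain ⟨σ, hσ0, ⟨K, hK, hσK⟩, hσ⟩ := exists_bound_dist_of_not_maximal
    ⟨_, hU.isSbMetric u v, h0⟩ ((A ×ˢ A).image fun p => dist p.1 p.2) (by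
      intro t ht
      obtain ⟨p, -, rfl⟩ := Finset.mem_image.1 ht
      exact hU.isSbMetric _ _)
  replace hσ : ∀ x ∈ A, ∀ y ∈ A, dist x y ≤ σ ∨ ∀ s ∈ distanceSet S b, s ≤ dist x y :=
    fun x hx y hy => hσ _ (Finset.mem_image.2 ⟨(x, y), by simp [hx, hy], rfl⟩)
  obtain ⟨g, hg, hgd⟩ := frequently_iff.1 (frequently_expand hU hN hst (hU.isSbMetric u v)
    (half_pos h0) (half_lt_self h0) hoff hK hσK hσ0 A) hW₁
  have : ∀ᶠ h in N', ∀ x ∈ A, ∀ y ∈ A, ∀ z ∈ A, dist (h x) y ≤ dist x (g z) + dist (g z) y := by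
    simp_rw [eventually_all_finset]
    intro x hx y hy z hz
    obtain ⟨h1, h1'⟩ := hgd z hz x hx
    obtain ⟨h2, h2'⟩ := hgd z hz y hy
    have h3 := dist_triangle_left x y z
    rw [dist_comm x (g z)]
    by_cases hlt : dist x y < dist (g z) x + dist (g z) y
    · exact (((tendsto_apply_of_mem hm' x).dist tendsto_const_nhds).eventually_lt_const hlt).mono
        fun h hh => hh.le
    -- Here `d(g z, x) = d(z, x)`, so `d(z, x)` did not increase and must be maximal; it then bounds
    -- `d(h x, y)`.
    · refine Eventually.of_forall fun h => ?_
      rcases hσ z hz x hx with h4 | h4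
      · linarith [h1' h4]
      · linarith [h4 _ (hU.isSbMetric (h x) y), dist_nonneg (x := g z) (y := y)]
  filter_upwards [this] with h hh
  exact mem_of_forall_dist_le hU hinv hprod hA hg h hh

end Spherical

/-! ### The three families and their strict inclusions -/

section Families

variable {U : Type*} [MetricSpace U] {S : AddSubgroup ℝ} {b : WithTop ℝ}

theorem IsUrysohnSpace.nonempty (hS : Dense (S : Set ℝ))
    (hb : b = ⊤ ∨ ∃ c : ℝ, c ∈ S ∧ 0 < c ∧ b = (c : WithTop ℝ))
    (hU : IsUrysohnSpace S b U) : Nonempty U := by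
  obtain ⟨r, hr, -⟩ := distanceSet_exists_pos_le hS hb one_pos
  have h0 := distanceSet_of_le hr S.zero_mem le_rfl (distanceSet_nonneg hr)
  obtain ⟨z, -⟩ := exists_tuple_of_pseudometric hU (fun _ _ : Unit => (0 : ℝ)) (fun _ _ => h0)
    (by simp) (by simp) (by simp)
  exact ⟨z ()⟩

theorem exists_dist_eq_dist_eq (hU : IsUrysohnSpace S b U) {u v : U} (huv : u ≠ v) {s t : ℝ}
    (hs : s ∈ distanceSet S b) (ht : t ∈ distanceSet S b) (hst : s ≤ t + dist u v)
    (hts : t ≤ s + dist u v) (h : dist u v ≤ s + t) :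
    ∃ w, dist u w = s ∧ dist v w = t := by
  classical
  have hs0 := distanceSet_nonneg hs
  have ht0 := distanceSet_nonneg ht
  obtain ⟨k, -, hk⟩ := exists_fixing_of_dist hU ∅ {u, v} {u} (by simp)
    (fun _ c => if c = u then s else t)
    (by simp [huv.symm, hs, ht]) (by simp [huv.symm, hst, hts, dist_comm v u])
    (by
      simp only [Finset.mem_singleton, Finset.mem_insert, forall_eq, forall_eq_or_imp, if_true,
        if_neg huv.symm, dist_self, dist_comm v u]
      exact ⟨⟨by linarith, h⟩, by linarith, by linarith⟩)
    (by simp) (by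
      simp only [Finset.mem_singleton, Finset.mem_insert, forall_eq, forall_eq_or_imp, if_true,
        if_neg huv.symm, dist_self]
      exact ⟨by linarith, by linarith⟩) (by simp)
  refine ⟨k u, ?_, ?_⟩
  · simpa [dist_comm] using hk u (by simp) u (by simp)
  · simpa [dist_comm, huv.symm] using hk u (by simp) v (by simp)

theorem exists_point_dist_eq (hU : IsUrysohnSpace S b U) (u : U) {s : ℝ} (hs : s ∈ distanceSet S b) :
    ∃ w, dist u w = s := by
  have hs0 := distanceSet_nonneg hs
  obtain ⟨k, -, hk⟩ := exists_fixing_of_dist hU ∅ {u} {u} (by simp) (fun _ _ => s)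
    (fun _ _ _ _ => hs) (by simp) (by simp [hs0]) (by simp) (by simp [hs0]) (by simp)
  exact ⟨k u, by rw [dist_comm]; exact hk u (by simp) u (by simp)⟩

/-- A finite set may be moved so that its distances to itself become `max (dist x y) t`. -/
theorem exists_dist_eq_max (hU : IsUrysohnSpace S b U) (A : Finset U) {t : ℝ}
    (ht : t ∈ distanceSet S b) :
    ∃ g : U ≃ᵢ U, ∀ x ∈ A, ∀ y ∈ A, dist (g x) y = max (dist x y) t := by
  have ht0 := distanceSet_nonneg ht
  obtain ⟨g, -, hg⟩ := exists_fixing_of_dist hU ∅ A A (by simp) (fun x y => max (dist x y) t)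
    (fun x _ y _ => distanceSet_max (hU.isSbMetric _ _) ht)
    (fun x _ c _ c' _ => by
      have := dist_triangle_right x c c'
      have := dist_nonneg (x := c) (y := c')
      exact max_le (by linarith [le_max_left (dist x c') t]) (by linarith [le_max_right (dist x c') t]))
    (fun x _ c _ c' _ => (dist_triangle_left c c' x).trans
      (add_le_add (le_max_left _ _) (le_max_left _ _)))
    (fun x _ x' _ c _ => by
      have := dist_triangle x x' c
      have := dist_nonneg (x := x) (y := x')
      exact max_le (by linarith [le_max_left (dist x' c) t]) (by linarith [le_max_right (dist x' c) t]))
    (fun x _ x' _ c _ => (dist_triangle_right x x' c).trans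
      (add_le_add (le_max_left _ _) (le_max_left _ _)))
    (by simp)
  exact ⟨g, hg⟩

/-- A finite set may be moved so that its distances to itself become `min (dist x y + t) M`. -/
theorem exists_dist_eq_min_add (hU : IsUrysohnSpace S b U) (A : Finset U) {t M : ℝ}
    (ht : t ∈ distanceSet S b) (hM : M ∈ distanceSet S b)
    (hMd : ∀ x ∈ A, ∀ y ∈ A, dist x y ≤ M) :
    ∃ g : U ≃ᵢ U, ∀ x ∈ A, ∀ y ∈ A, dist (g x) y = min (dist x y + t) M := by
  have ht0 := distanceSet_nonneg ht
  have hM0 := distanceSet_nonneg hM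
  have hle : ∀ x ∈ A, ∀ y ∈ A, dist x y ≤ min (dist x y + t) M := fun x hx y hy =>
    le_min (by linarith) (hMd x hx y hy)
  obtain ⟨g, -, hg⟩ := exists_fixing_of_dist hU ∅ A A (by simp) (fun x y => min (dist x y + t) M)
    (fun x hx y hy => by
      refine distanceSet_of_le hM ?_ (dist_nonneg.trans (hle x hx y hy)) (min_le_right _ _)
      rcases min_choice (dist x y + t) M with h | h <;> rw [h]
      exacts [S.add_mem (hU.isSbMetric x y).1 ht.1, hM.1])
    (fun x _ c _ c' _ => by
      have h1 := dist_triangle_right x c c'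
      have h2 := dist_nonneg (x := c) (y := c')
      rcases min_choice (dist x c' + t) M with h | h <;> rw [h]
      · exact (min_le_left _ _).trans (by linarith)
      · exact (min_le_right _ _).trans (by linarith))
    (fun x hx c hc c' hc' => (dist_triangle_left c c' x).trans
      (add_le_add (hle x hx c hc) (hle x hx c' hc')))
    (fun x _ x' _ c _ => by
      have h1 := dist_triangle x x' c
      have h2 := dist_nonneg (x := x) (y := x')
      rcases min_choice (dist x' c + t) M with h | h <;> rw [h]
      · exact (min_le_left _ _).trans (by linarith)
      · exact (min_le_right _ _).trans (by linarith))
    (fun x hx x' hx' c hc => (dist_triangle_right x x' c).trans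
      (add_le_add (hle x hx c hc) (hle x' hx' c hc)))
    (by simp)
  exact ⟨g, hg⟩

theorem isNhdsOne_generate_stabilizerSets :
    IsNhdsOne (Filter.generate (stabilizerSets U)) := by
  refine IsNhdsOne.generate ?_ ?_ ?_ ?_
  · rintro _ ⟨A, -, rfl⟩ a -
    rfl
  · rintro _ ⟨A, hA, rfl⟩
    refine ⟨_, mem_generate_of_mem ⟨A, hA, rfl⟩, fun x hx y hy a ha => ?_⟩
    rw [IsometryEquiv.mul_apply, hy a ha, hx a ha]
  · rintro _ ⟨A, hA, rfl⟩
    refine mem_of_superset (mem_generate_of_mem ⟨A, hA, rfl⟩) fun g hg a ha => ?_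
    conv_lhs => rw [← hg a ha]
    simp
  · rintro h _ ⟨A, hA, rfl⟩
    refine mem_of_superset (mem_generate_of_mem ⟨_, hA.image ⇑h⁻¹, rfl⟩) fun g hg a ha => ?_
    rw [IsometryEquiv.mul_apply, IsometryEquiv.mul_apply, hg _ (Set.mem_image_of_mem _ ha),
      IsometryEquiv.apply_inv_self]

theorem containsStabilizers_generate :
    ContainsStabilizers (Filter.generate (stabilizerSets U)) := by
  classical
  intro V hV
  induction hV with
  | basic h =>
    obtain ⟨A, hA, rfl⟩ := h
    exact ⟨hA.toFinset, fun g hg a ha => hg a (by simpa using ha)⟩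
  | univ => exact ⟨∅, fun _ _ => trivial⟩
  | superset _ hst ih =>
    obtain ⟨A, hA⟩ := ih
    exact ⟨A, fun g hg => hst (hA g hg)⟩
  | inter _ _ ih₁ ih₂ =>
    obtain ⟨A, hA⟩ := ih₁
    obtain ⟨B, hB⟩ := ih₂
    exact ⟨A ∪ B, fun g hg => ⟨hA g fun a ha => hg a (Finset.mem_union_left _ ha),
      hB g fun a ha => hg a (Finset.mem_union_right _ ha)⟩⟩

theorem isNhdsOne_generate_sphericalSets (hS : Dense (S : Set ℝ))
    (hb : b = ⊤ ∨ ∃ c : ℝ, c ∈ S ∧ 0 < c ∧ b = (c : WithTop ℝ)) (hU : IsUrysohnSpace S b U) :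
    IsNhdsOne (Filter.generate (sphericalSets U)) := by
  refine IsNhdsOne.generate ?_ ?_ ?_ ?_
  · rintro _ ⟨u, v, -, rfl⟩
    exact le_refl (dist u v)
  · rintro _ ⟨u, v, huv, rfl⟩
    -- The point `w` below lies on a segment from `u` to `v`, so the bounds for `(u, w)` and `(w,
    -- v)` add up to the one for `(u, v)`.
    obtain ⟨s, hs, hs0, hsle⟩ := distanceSet_exists_pos_le hS hb (half_pos huv)
    have ht : dist u v - s ∈ distanceSet S b := distanceSet_of_le (hU.isSbMetric u v)
      (S.sub_mem (hU.isSbMetric u v).1 hs.1) (by linarith) (by linarith)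
    obtain ⟨w, huw, hvw⟩ := exists_dist_eq_dist_eq hU (dist_pos.1 huv) hs ht (by linarith)
      (by linarith) (by linarith)
    rw [dist_comm] at hvw
    refine ⟨_, inter_mem (mem_generate_of_mem ⟨u, w, by linarith, rfl⟩)
      (mem_generate_of_mem ⟨w, v, by linarith, rfl⟩), fun x hx y hy => ?_⟩
    have h1 : dist (x (y u)) (x w) ≤ dist u w := by rw [x.dist_eq]; exact hy.1
    have h2 : dist (x w) v ≤ dist w v := hx.2
    have h3 := dist_triangle (x (y u)) (x w) v
    change dist (x (y u)) v ≤ dist u v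
    linarith
  · rintro _ ⟨u, v, huv, rfl⟩
    refine mem_of_superset (mem_generate_of_mem ⟨v, u, by rwa [dist_comm], rfl⟩) fun g hg => ?_
    change dist (g v) u ≤ dist v u at hg
    change dist (g⁻¹ u) v ≤ dist u v
    rwa [dist_apply_left, inv_inv, dist_comm, dist_comm u v]
  · rintro h _ ⟨u, v, huv, rfl⟩
    refine mem_of_superset (mem_generate_of_mem ⟨h⁻¹ u, h⁻¹ v, ?_, rfl⟩) fun g hg => ?_
    · rwa [h⁻¹.dist_eq]
    · change dist (g (h⁻¹ u)) (h⁻¹ v) ≤ dist (h⁻¹ u) (h⁻¹ v) at hg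
      change dist (h (g (h⁻¹ u))) v ≤ dist u v
      rwa [dist_apply_left, ← h⁻¹.dist_eq u v]

theorem setOf_dist_le_mem_generate_metricSets (hS : Dense (S : Set ℝ))
    (hb : b = ⊤ ∨ ∃ c : ℝ, c ∈ S ∧ 0 < c ∧ b = (c : WithTop ℝ)) (u : U) (ε : ℝ) (hε : 0 < ε) :
    {g : U ≃ᵢ U | dist (g u) u ≤ ε} ∈ Filter.generate (metricSets S b U) := by
  obtain ⟨r, hr, hr0, hrε⟩ := distanceSet_exists_pos_le hS hb hε
  exact mem_of_superset (mem_generate_of_mem ⟨u, r, hr, hr0.ne', rfl⟩) fun g hg => le_trans hg hrε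

theorem isNhdsOne_generate_metricSets (hS : Dense (S : Set ℝ))
    (hb : b = ⊤ ∨ ∃ c : ℝ, c ∈ S ∧ 0 < c ∧ b = (c : WithTop ℝ)) :
    IsNhdsOne (Filter.generate (metricSets S b U)) := by
  refine IsNhdsOne.generate ?_ ?_ ?_ ?_
  · rintro _ ⟨u, ε, hε, -, rfl⟩
    simpa using distanceSet_nonneg hε
  · rintro _ ⟨u, ε, hε, hε0, rfl⟩
    have hpos := (distanceSet_nonneg hε).lt_of_ne' hε0
    refine ⟨_, setOf_dist_le_mem_generate_metricSets hS hb u _ (half_pos hpos), fun x hx y hy => ?_⟩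
    have h1 : dist (x (y u)) (x u) ≤ ε / 2 := by rw [x.dist_eq]; exact hy
    have h2 : dist (x u) u ≤ ε / 2 := hx
    have h3 := dist_triangle (x (y u)) (x u) u
    change dist (x (y u)) u ≤ ε
    linarith
  · rintro _ ⟨u, ε, hε, hε0, rfl⟩
    refine mem_of_superset (mem_generate_of_mem ⟨u, ε, hε, hε0, rfl⟩) fun g hg => ?_
    change dist (g u) u ≤ ε at hg
    change dist (g⁻¹ u) u ≤ ε
    rwa [dist_apply_left, inv_inv, dist_comm]
  · rintro h _ ⟨u, ε, hε, hε0, rfl⟩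
    refine mem_of_superset (mem_generate_of_mem ⟨h⁻¹ u, ε, hε, hε0, rfl⟩) fun g hg => ?_
    change dist (g (h⁻¹ u)) (h⁻¹ u) ≤ ε at hg
    change dist (h (g (h⁻¹ u))) u ≤ ε
    rwa [dist_apply_left]

theorem setOf_dist_le_mem_generate_sphericalSets (hS : Dense (S : Set ℝ))
    (hb : b = ⊤ ∨ ∃ c : ℝ, c ∈ S ∧ 0 < c ∧ b = (c : WithTop ℝ)) (hU : IsUrysohnSpace S b U)
    (u : U) (ε : ℝ) (hε : 0 < ε) :
    {g : U ≃ᵢ U | dist (g u) u ≤ ε} ∈ Filter.generate (sphericalSets U) := by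
  -- Two points within `r` of `w` are within `2r ≤ ε` of each other.
  obtain ⟨r, hr, hr0, hrε⟩ := distanceSet_exists_pos_le hS hb (half_pos hε)
  obtain ⟨w, hw⟩ := exists_point_dist_eq hU u hr
  refine mem_of_superset (mem_generate_of_mem ⟨u, w, by rwa [hw], rfl⟩) fun g hg => ?_
  change dist (g u) w ≤ dist u w at hg
  change dist (g u) u ≤ ε
  have := dist_triangle_right (g u) u w
  linarith

/-- At distance `b` the spherical condition is vacuous. Below `b` there is a `w` such that `u` lies
between `v` and `w`; an upper bound on `d(g u, w)` then gives the lower bound on `d(g u, v)`. -/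
theorem generate_sphericalEqSets
    (hb : b = ⊤ ∨ ∃ c : ℝ, c ∈ S ∧ 0 < c ∧ b = (c : WithTop ℝ)) (hU : IsUrysohnSpace S b U) :
    Filter.generate (sphericalEqSets b U) = Filter.generate (sphericalSets U) := by
  refine le_antisymm (le_generate_iff.2 ?_) (le_generate_iff.2 ?_)
  · rintro _ ⟨u, v, huv, rfl⟩
    by_cases hlt : (dist u v : WithTop ℝ) < b
    · exact mem_of_superset (mem_generate_of_mem ⟨u, v, huv, hlt, rfl⟩) fun g hg => le_of_eq hg
    · refine mem_of_superset univ_mem fun g _ => ?_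
      exact WithTop.coe_le_coe.1 ((hU.isSbMetric (g u) v).2.2.trans (not_lt.1 hlt))
  · rintro _ ⟨u, v, huv, hlt, rfl⟩
    obtain ⟨s, hs, hs0, hsum⟩ : ∃ s ∈ distanceSet S b, 0 < s ∧ dist u v + s ∈ distanceSet S b := by
      have huvS := (hU.isSbMetric u v).1
      rcases hb with rfl | ⟨c, hc, hc0, rfl⟩
      · exact ⟨dist u v, hU.isSbMetric u v, huv, S.add_mem huvS huvS, by positivity, le_top⟩
      · have hlt' : dist u v < c := WithTop.coe_lt_coe.1 hlt
        have hcD : c ∈ distanceSet S (c : WithTop ℝ) := ⟨hc, hc0.le, le_rfl⟩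
        exact ⟨c - dist u v, distanceSet_of_le hcD (S.sub_mem hc huvS) (by linarith) (by linarith),
          by linarith, by rwa [add_sub_cancel]⟩
    obtain ⟨w, huw, hvw⟩ := exists_dist_eq_dist_eq hU (dist_pos.1 huv) hs hsum (by linarith)
      (by linarith) (by linarith)
    refine mem_of_superset (inter_mem (mem_generate_of_mem ⟨u, v, huv, rfl⟩)
      (mem_generate_of_mem ⟨u, w, by rwa [huw], rfl⟩)) fun g hg => ?_
    obtain ⟨h1, h2⟩ := hg
    change dist (g u) v ≤ dist u v at h1
    change dist (g u) w ≤ dist u w at h2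
    change dist (g u) v = dist u v
    have := dist_triangle_left v w (g u)
    linarith

theorem exists_finset_of_mem_generate_sphericalSets {V : Set (U ≃ᵢ U)}
    (hV : V ∈ Filter.generate (sphericalSets U)) :
    ∃ P : Finset U, ∀ g : U ≃ᵢ U, (∀ x ∈ P, ∀ y ∈ P, x ≠ y → dist (g x) y ≤ dist x y) → g ∈ V := by
  classical
  induction hV with
  | basic h =>
    obtain ⟨u, v, huv, rfl⟩ := h
    exact ⟨{u, v}, fun g hg => hg u (by simp) v (by simp) (dist_pos.1 huv)⟩
  | univ => exact ⟨∅, fun _ _ => trivial⟩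
  | superset _ hst ih =>
    obtain ⟨A, hA⟩ := ih
    exact ⟨A, fun g hg => hst (hA g hg)⟩
  | inter _ _ ih₁ ih₂ =>
    obtain ⟨A, hA⟩ := ih₁
    obtain ⟨B, hB⟩ := ih₂
    exact ⟨A ∪ B, fun g hg => ⟨
      hA g fun x hx y hy => hg x (Finset.mem_union_left _ hx) y (Finset.mem_union_left _ hy),
      hB g fun x hx y hy => hg x (Finset.mem_union_right _ hx) y (Finset.mem_union_right _ hy)⟩⟩

theorem exists_finset_of_mem_generate_metricSets {V : Set (U ≃ᵢ U)}
    (hV : V ∈ Filter.generate (metricSets S b U)) :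
    ∃ (P : Finset U) (ε : ℝ), 0 < ε ∧ ∀ g : U ≃ᵢ U, (∀ x ∈ P, dist (g x) x ≤ ε) → g ∈ V := by
  classical
  induction hV with
  | basic h =>
    obtain ⟨u, ε, hε, hε0, rfl⟩ := h
    exact ⟨{u}, ε, (distanceSet_nonneg hε).lt_of_ne' hε0, fun g hg => hg u (by simp)⟩
  | univ => exact ⟨∅, 1, one_pos, fun _ _ => trivial⟩
  | superset _ hst ih =>
    obtain ⟨A, ε, hε, hA⟩ := ih
    exact ⟨A, ε, hε, fun g hg => hst (hA g hg)⟩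
  | inter _ _ ih₁ ih₂ =>
    obtain ⟨A, ε, hε, hA⟩ := ih₁
    obtain ⟨B, δ, hδ, hB⟩ := ih₂
    exact ⟨A ∪ B, min ε δ, lt_min hε hδ, fun g hg => ⟨
      hA g fun x hx => (hg x (Finset.mem_union_left _ hx)).trans (min_le_left _ _),
      hB g fun x hx => (hg x (Finset.mem_union_right _ hx)).trans (min_le_right _ _)⟩⟩

/-- With `t` below all nonzero distances in `P`, the distances `max (dist x y) t` satisfy the
spherical conditions on `P`, yet every point moves by `t`. -/
theorem stabilizer_notMem_generate_sphericalSets (hS : Dense (S : Set ℝ))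
    (hb : b = ⊤ ∨ ∃ c : ℝ, c ∈ S ∧ 0 < c ∧ b = (c : WithTop ℝ)) (hU : IsUrysohnSpace S b U)
    (u : U) : {g : U ≃ᵢ U | g u = u} ∉ Filter.generate (sphericalSets U) := by
  classical
  intro hmem
  obtain ⟨P, hP⟩ := exists_finset_of_mem_generate_sphericalSets hmem
  have hev : ∀ᶠ η in 𝓝[>] (0 : ℝ), ∀ x ∈ P, ∀ y ∈ P, x ≠ y → η < dist x y := by
    simp_rw [eventually_all_finset]
    intro x _ y _
    by_cases hxy : x = y
    · exact Eventually.of_forall fun _ h => absurd hxy h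
    · exact ((eventually_lt_nhds (dist_pos.2 hxy)).filter_mono nhdsWithin_le_nhds).mono
        fun η hη _ => hη
  obtain ⟨η, hη, hη0⟩ := (hev.and self_mem_nhdsWithin).exists
  obtain ⟨t, ht, ht0, htη⟩ := distanceSet_exists_pos_le hS hb hη0
  obtain ⟨g, hg⟩ := exists_dist_eq_max hU (insert u P) ht
  have h1 : g u = u := hP g fun x hx y hy hxy => by
    rw [hg x (by simp [hx]) y (by simp [hy])]
    exact max_le le_rfl (by linarith [hη x hx y hy hxy])
  have h2 := hg u (by simp) u (by simp)
  rw [h1, dist_self, max_eq_right ht0.le] at h2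
  exact ht0.ne h2

/-- Distances `min (dist x y + t) M` give displacements at most `t` but increase `dist u v`, which
is not maximal. -/
theorem spherical_notMem_generate_metricSets (hS : Dense (S : Set ℝ))
    (hb : b = ⊤ ∨ ∃ c : ℝ, c ∈ S ∧ 0 < c ∧ b = (c : WithTop ℝ)) (hU : IsUrysohnSpace S b U)
    {u v : U} (huv : ∃ K ∈ distanceSet S b, dist u v < K) :
    {g : U ≃ᵢ U | dist (g u) v ≤ dist u v} ∉ Filter.generate (metricSets S b U) := by
  classical
  intro hmem
  obtain ⟨K, hK, huvK⟩ := huv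
  obtain ⟨P, ε, hε, hP⟩ := exists_finset_of_mem_generate_metricSets hmem
  obtain ⟨t, ht, ht0, htε⟩ := distanceSet_exists_pos_le hS hb hε
  obtain ⟨M, hM, hKM, hMd⟩ := exists_bound_dist hU (insert u (insert v P)) hK
  obtain ⟨g, hg⟩ := exists_dist_eq_min_add hU _ ht hM hMd
  have h1 : dist (g u) v ≤ dist u v := hP g fun x hx => by
    rw [hg x (by simp [hx]) x (by simp [hx]), dist_self]
    exact (min_le_left _ _).trans (by linarith)
  rw [hg u (by simp) v (by simp)] at h1
  exact absurd h1 (not_le.2 (lt_min (by linarith) (by linarith)))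

end Families

/-- In the order of `GroupTopology`, `τ ≤ τ'` means that `τ'` is coarser than `τ`, and `⊤` is
the trivial topology, whose only open sets are `∅` and the whole group. -/
theorem theoremD (S : AddSubgroup ℝ) (hS : Dense (S : Set ℝ)) (b : WithTop ℝ)
    (hb : b = ⊤ ∨ ∃ c : ℝ, c ∈ S ∧ 0 < c ∧ b = (c : WithTop ℝ))
    (U : Type*) [MetricSpace U] (hU : IsUrysohnSpace S b U) :
    ∃ τst τsph τm : GroupTopology (U ≃ᵢ U),
      GeneratesAtOne (stabilizerSets U) τst ∧
      GeneratesAtOne (sphericalSets U) τsph ∧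
      GeneratesAtOne (sphericalEqSets b U) τsph ∧
      GeneratesAtOne (metricSets S b U) τm ∧
      τst < τsph ∧ τsph < τm ∧ τm < ⊤ ∧
      {τ : GroupTopology (U ≃ᵢ U) | τst ≤ τ} = {τst, τsph, τm, ⊤} := by
  have hne : Nonempty U := hU.nonempty hS hb
  obtain ⟨u⟩ := id hne
  -- Two positive distances `r₁ < r₀`: `r₁` is not maximal, and a displacement of `r₀` violates the
  -- bound `r₁`.
  obtain ⟨r₀, hr₀, hr₀pos, -⟩ := distanceSet_exists_pos_le hS hb one_pos
  obtain ⟨r₁, hr₁, hr₁pos, hr₁₀⟩ := distanceSet_exists_pos_le hS hb (half_pos hr₀pos)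
  obtain ⟨τst, hst⟩ := (isNhdsOne_generate_stabilizerSets (U := U)).exists_groupTopology
  obtain ⟨τsph, hsph⟩ := (isNhdsOne_generate_sphericalSets hS hb hU).exists_groupTopology
  obtain ⟨τm, hm⟩ := (isNhdsOne_generate_metricSets (U := U) hS hb).exists_groupTopology
  have hstsph : τst ≤ τsph := by
    rw [GroupTopology.le_iff_nhds_one, hst, hsph, le_generate_iff]
    rintro _ ⟨x, y, -, rfl⟩
    refine mem_of_superset (mem_generate_of_mem ⟨{x}, Set.finite_singleton x, rfl⟩) fun g hg => ?_
    exact (congrArg (dist · y) (hg x rfl)).le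
  have hsphm : τsph ≤ τm := by
    rw [GroupTopology.le_iff_nhds_one, hsph, hm, le_generate_iff]
    rintro _ ⟨x, ε, hε, hε0, rfl⟩
    exact setOf_dist_le_mem_generate_sphericalSets hS hb hU x ε
      ((distanceSet_nonneg hε).lt_of_ne' hε0)
  have hstab : ∀ x : U, {g : U ≃ᵢ U | g x = x} ∈ Filter.generate (stabilizerSets U) := fun x =>
    mem_generate_of_mem ⟨{x}, Set.finite_singleton x, by simp⟩
  refine ⟨τst, τsph, τm, hst, hsph, hsph.trans (generate_sphericalEqSets hb hU).symm, hm,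
    hstsph.lt_of_ne ?_, hsphm.lt_of_ne ?_, le_top.lt_of_ne ?_, ?_⟩
  · rintro rfl
    refine stabilizer_notMem_generate_sphericalSets hS hb hU u ?_
    rw [← hsph, hst]
    exact hstab u
  · rintro rfl
    obtain ⟨v, huv⟩ := exists_point_dist_eq hU u hr₁
    refine spherical_notMem_generate_metricSets hS hb hU (u := u) (v := v)
      ⟨r₀, hr₀, by linarith⟩ ?_
    rw [← hm, hsph]
    exact mem_generate_of_mem ⟨u, v, by linarith, rfl⟩
  · rintro rfl
    obtain ⟨v, huv⟩ := exists_point_dist_eq hU u hr₀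
    obtain ⟨g, rfl⟩ := exists_isometryEquiv_apply_eq hU u v
    have hmem := setOf_dist_le_mem_generate_metricSets (U := U) hS hb u r₁ hr₁pos
    rw [← hm, GroupTopology.toTopologicalSpace_top, _root_.nhds_top, mem_top] at hmem
    have : dist (g u) u ≤ r₁ := hmem.ge (Set.mem_univ g)
    rw [dist_comm] at this
    linarith
  · ext τ
    simp only [Set.mem_ofPred_eq, Set.mem_insert_iff, Set.mem_singleton_iff]
    constructor
    · intro hτ
      have hN := τ.isNhdsOne
      set N := @nhds (U ≃ᵢ U) τ.toTopologicalSpace 1 with hNdef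
      rw [GroupTopology.le_iff_nhds_one, hst, ← hNdef] at hτ
      have hNst : ContainsStabilizers N := fun V hV => containsStabilizers_generate V (hτ hV)
      by_cases h1 : ∀ x : U, {g : U ≃ᵢ U | g x = x} ∈ N
      · left
        refine GroupTopology.eq_of_nhds_one ?_
        rw [hst, ← hNdef]
        refine le_antisymm (le_generate_iff.2 ?_) hτ
        rintro _ ⟨A, hA, rfl⟩
        simpa [Set.ofPred_forall] using (biInter_mem hA).2 fun a _ => h1 a
      right
      push Not at h1
      obtain ⟨x, hx⟩ := h1
      by_cases h2 : ∀ x y : U, 0 < dist x y → {g : U ≃ᵢ U | dist (g x) y ≤ dist x y} ∈ N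
      · left
        refine GroupTopology.eq_of_nhds_one ?_
        rw [hsph, ← hNdef]
        have hmem : ∀ x y : U, 0 < dist x y →
            {g : U ≃ᵢ U | dist (g x) y ≤ dist x y} ∈ Filter.generate (sphericalSets U) :=
          fun x y hxy => mem_generate_of_mem ⟨x, y, hxy, rfl⟩
        refine le_antisymm (le_generate_iff.2 ?_) fun V hV => mem_of_stabilizer_notMem hU hN hNst hx
          hmem (setOf_dist_le_mem_generate_sphericalSets hS hb hU) hV
        rintro _ ⟨x, y, hxy, rfl⟩
        exact h2 x y hxy
      right
      push Not at h2
      obtain ⟨x, y, hxy, hxyN⟩ := h2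
      by_cases h3 : ∀ (x : U) (ε : ℝ), 0 < ε → {g : U ≃ᵢ U | dist (g x) x ≤ ε} ∈ N
      · left
        refine GroupTopology.eq_of_nhds_one ?_
        rw [hm, ← hNdef]
        refine le_antisymm (le_generate_iff.2 ?_) fun V hV => mem_of_spherical_notMem hS hb hU hN
          hNst h3 hxy hxyN (setOf_dist_le_mem_generate_metricSets hS hb) hV
        rintro _ ⟨x, ε, hε, hε0, rfl⟩
        exact h3 x ε ((distanceSet_nonneg hε).lt_of_ne' hε0)
      right
      push Not at h3
      obtain ⟨x, ε, hε, hxε⟩ := h3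
      refine GroupTopology.eq_of_nhds_one ?_
      rw [GroupTopology.toTopologicalSpace_top, _root_.nhds_top, ← hNdef, eq_top_iff]
      exact fun V hV => mem_top.2 (eq_univ_of_not_small hU hN hNst hε hxε hV)
    · rintro (rfl | rfl | rfl | rfl)
      exacts [le_rfl, hstsph, hstsph.trans hsphm, le_top]
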